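/- **Setting.** Let $Q\in\mathbb S^n$, $c\in\mathbb R^n$, let $A\in\mathbb R^{m\times n}$ have full row rank, $b\in\mathbb R^m$, $B\subseteq[n]$, and let $\mathcal P\subseteq\mathbb S^{n+1}$ be a polyhedral convex cone with dual cone $\mathcal P^*$ (in $\mathbb S^{n+1}$), $\sigma>0$, $\widetilde W\in\mathbb S^{n+1}$. All norms are Frobenius norms, $\langle X,Y\rangle=\operatorname{Tr}(XY^\top)$, $\Pi_{\mathcal P^*}$ is the metric projection onto $\mathcal P^*$ in $\mathbb S^{n+1}$, $e_1$ is the first unit vector and $e$ the all-ones vector. Matrices in $\mathbb S^{n+1}$ are written in blocks of sizes $1$ and $n$. For $\mu\in\mathbb R^{B}$ let $\operatorname{diag}_B(X)=(X_{ii})_{i\in B}$, and let $\operatorname{diag}_B^*(\mu)$ be the $n\times n$ diagonal matrix with entries $\mu_i$ for $i\in B$ and $0$ otherwise. For $r\ge 1$ put $$\mathcal M_r=\{R\in\mathbb R^{n\times r}: AR=be_1^\top,\ \operatorname{diag}_B(RR^\top)=R_Be_1\},\qquad \widehat R=\begin{pmatrix}e_1^\top\\ R\end{pmatrix},$$ $$C=\begin{pmatrix}0&c^\top\\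 c&Q\end{pmatrix},\qquad f_r(R)=\langle C,\widehat R\widehat R^\top\rangle+\tfrac\sigma2\big\|\Pi_{\mathcal P^*}(\sigma^{-1}\widetilde W-\widehat R\widehat R^\top)\big\|^2 ,$$ $$h_R(H)=\big(AH,\ 2\operatorname{diag}_B(HR^\top)-H_Be_1\big),\quad h_R^*(\lambda,\mu)=A^\top\lambda+\operatorname{diag}_B^*(\mu)(2R-ee_1^\top),\quad \mathrm T_R\mathcal M_r=\ker h_R .$$ For $R\in\mathcal M_r$ and $U\in \mathrm T_R\mathcal M_r$ let $\operatorname{Rtr}_R(U)=\arg\min\{\|X-(R+U)\|^2: X\in\mathcal M_r\}$. For $\mu\in\mathbb R^B$ put $$W=\sigma\Pi_{\mathcal P^*}(\sigma^{-1}\widetilde W-\widehat R\widehat R^\top),\quad L=Q-\operatorname{diag}_B^*(\mu)-W_{22},\quad q=2c+\operatorname{diag}_B^*(\mu)e-2W_{21}.$$ LICQ at $R\in\mathcal M_r$ means that the gradients at $R$ of the $mr+|B|$ scalar constraints defining $\mathcal M_r$ are linearly independent. Assume that there is $\bar r\ge1$ such that for every $s\ge\bar r$ the set $\mathcal M_s$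 is non-empty and LICQ holds at each of its points. Let $r\ge\bar r$ and write $P=[R,0_{n\times\tau}]$. **(a) Second-order expansion.** Let $R\in\mathcal M_r$. Then $f_r$ is differentiable at $R$, and the equation $h_Rh_R^*(\lambda,\mu)=h_R(\nabla f_r(R))$ has a unique solution $(\lambda,\mu)$. Let $L$ be formed with this $\mu$. For every $\tau\ge1$ and every $H\in\mathbb R^{n\times\tau}$ with $AH=0$, put $U=[0_{n\times r},H]$. Then $P\in\mathcal M_{r+\tau}$, $U\in\mathrm T_P\mathcal M_{r+\tau}$, $\operatorname{Rtr}_P(tU)$ is a single point for all $t$ near $0$, and $$f_{r+\tau}(\operatorname{Rtr}_P(tU))=f_r(R)+\langle L,HH^\top\rangle t^2+o(t^2)\qquad(t\to0).$$ **(b) Escaping a saddle point.** Let $(R;\lambda,\mu)$ be a KKT point of $\min\{f_r(R):R\in\mathcal M_r\}$, i.e. $R\in\mathcal M_r$ and $2LR+qe_1^\top-A^\top\lambda=0$. Put $A^\dagger=A^\top(AA^\top)^{-1}$, $J_A=I-A^\dagger A$, and let $S=C-\mathcal A^*(y)-W$ be the recovered dual matrix, where $$\mathcal A(Y)=\big(AY_{21};\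 \operatorname{vec}(AY_{22}-bY_{12});\ \operatorname{diag}_B(Y_{22})-(Y_{21})_B;\ Y_{11}\big),\qquad y=(\lambda_1;\operatorname{vec}(\lambda_2);\mu;\alpha),$$ $$\lambda_1=(A^\dagger)^\top(q+LA^\dagger b),\quad \lambda_2=(A^\dagger)^\top L(2I-A^\dagger A),\quad \alpha=-(J_ARe_1)^\top L(J_ARe_1)-W_{11},$$ and $\mathcal A^*$ is the adjoint of $\mathcal A$ on $\mathbb S^{n+1}$. Let $\tau\ge1$ and let every column of $V\in\mathbb R^{(n+1)\times\tau}$ be an eigenvector of $S$ for a negative eigenvalue. Put $U=[0_{n\times r},\,J_A(-Re_1,\ I)V]$ and $\beta=\langle S,VV^\top\rangle$. Then $\beta<0$, $P\in\mathcal M_{r+\tau}$, $U\in\mathrm T_P\mathcal M_{r+\tau}$, $\operatorname{Rtr}_P(tU)$ is a single point for all $t$ near $0$, and $$f_{r+\tau}(\operatorname{Rtr}_P(tU))=f_r(R)+\beta t^2+o(t^2)\qquad(t\to0);$$ in particular $f_{r+\tau}(\operatorname{Rtr}_P(tU))<f_r(R)$ for all sufficiently small $t\neq0$. -/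

import Mathlib

open Matrix Filter Topology Asymptotics

attribute [local instance] Matrix.frobeniusNormedAddCommGroup Matrix.frobeniusNormedSpace

namespace RNNAL

noncomputable section

/-! ### Real matrices as a Euclidean space -/

/-- The trace inner product `⟪X, Y⟫ = Tr (X Yᵀ)`; its norm is the Frobenius norm. -/
instance frobeniusInner {p q : Type*} [Fintype p] [Fintype q] :
    InnerProductSpace ℝ (Matrix p q ℝ) where
  inner X Y := trace (X * Yᵀ)
  norm_sq_eq_re_inner X := by
    rw [Matrix.frobenius_norm_def, ← Real.sqrt_eq_rpow, Real.sq_sqrt (by positivity)]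
    simp [trace, mul_apply, sq]
  conj_inner_symm X Y := by
    simp [trace, mul_apply, mul_comm]
  add_left X Y Z := by
    change trace ((X + Y) * Zᵀ) = trace (X * Zᵀ) + trace (Y * Zᵀ)
    rw [Matrix.add_mul, trace_add]
  smul_left X Y a := by simp

instance matrixComplete {p q : Type*} [Fintype p] [Fintype q] :
    CompleteSpace (Matrix p q ℝ) := FiniteDimensional.complete ℝ _

theorem inner_def {p q : Type*} [Fintype p] [Fintype q] (X Y : Matrix p q ℝ) :
    inner ℝ X Y = trace (X * Yᵀ) := rfl

/-! ### Cones of symmetric matrices and metric projections -/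

/-- `K` is a polyhedral convex cone in the space of symmetric matrices: it is cut out of that
space by finitely many homogeneous linear inequalities. -/
def IsPolyhedralCone {p : Type*} [Fintype p] (K : Set (Matrix p p ℝ)) : Prop :=
  ∃ (k : ℕ) (N : Fin k → Matrix p p ℝ), (∀ i, (N i).IsSymm) ∧
    K = {X | X.IsSymm ∧ ∀ i, 0 ≤ inner ℝ (N i) X}

/-- The dual cone `K* = {Z symmetric | ⟪X, Z⟫ ≥ 0 for all X ∈ K}`. -/
def dualCone {p : Type*} [Fintype p] (K : Set (Matrix p p ℝ)) : Set (Matrix p p ℝ) :=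
  {Z | Z.IsSymm ∧ ∀ X ∈ K, 0 ≤ inner ℝ X Z}

/-- The (set-valued) metric projection onto `K`: the set of points of `K` nearest to `V` in the
Frobenius norm. -/
def metricProj {p q : Type*} [Fintype p] [Fintype q] (K : Set (Matrix p q ℝ))
    (V : Matrix p q ℝ) : Set (Matrix p q ℝ) :=
  {X | X ∈ K ∧ ∀ X' ∈ K, ‖X - V‖ ≤ ‖X' - V‖}

/-- The projection `Π_K` as a map, for sets `K` with unique nearest points
(such as the dual cones, see `existsUnique_mem_metricProj_dualCone`). -/
def proj {p q : Type*} [Fintype p] [Fintype q] (K : Set (Matrix p q ℝ))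
    (X : Matrix p q ℝ) : Matrix p q ℝ :=
  Classical.epsilon fun Z => Z ∈ metricProj K X

/-- The projection onto a dual cone is well defined. -/
theorem existsUnique_mem_metricProj_dualCone {p : Type*} [Fintype p]
    (K : Set (Matrix p p ℝ)) (X : Matrix p p ℝ) : ∃! Z, Z ∈ metricProj (dualCone K) X := by
  have hne : (dualCone K).Nonempty := ⟨0, by simp [dualCone, Matrix.IsSymm]⟩
  have hcv : Convex ℝ (dualCone K) := by
    intro Y hY Z hZ s t hs ht _
    refine ⟨?_, fun W hW => ?_⟩
    · have h1 : Yᵀ = Y := hY.1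
      have h2 : Zᵀ = Z := hZ.1
      simp [Matrix.IsSymm, h1, h2]
    · rw [inner_add_right, inner_smul_right, inner_smul_right]
      have := hY.2 W hW
      have := hZ.2 W hW
      positivity
  have hcl : IsClosed (dualCone K) := by
    have : dualCone K = {Z | Zᵀ = Z} ∩ ⋂ W ∈ K, {Z | 0 ≤ inner ℝ W Z} := by
      ext Z; simp [dualCone, Matrix.IsSymm]
    rw [this]
    refine IsClosed.inter ?_ (isClosed_biInter fun W _ => ?_)
    · exact isClosed_eq (Continuous.matrix_transpose continuous_id) continuous_id
    · exact isClosed_le continuous_const (by fun_prop)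
  obtain ⟨Z, hZ, hZm⟩ := exists_norm_eq_iInf_of_complete_convex hne hcl.isComplete hcv X
  have hle : ∀ Y ∈ dualCone K, ‖Z - X‖ ≤ ‖Y - X‖ := fun Y hY => by
    rw [norm_sub_rev Z, norm_sub_rev Y, hZm]
    exact ciInf_le ⟨0, by rintro _ ⟨w, rfl⟩; exact norm_nonneg _⟩ (⟨Y, hY⟩ : dualCone K)
  refine ⟨Z, ⟨hZ, hle⟩, fun Y hY => ?_⟩
  have hYZ : ‖Y - X‖ = ‖Z - X‖ := le_antisymm (hY.2 Z hZ) (hle Y hY.1)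
  have h1 := (norm_eq_iInf_iff_real_inner_le_zero hcv hZ).1 hZm Y hY.1
  have h2 : ‖Y - X‖ ^ 2 = ‖Y - Z‖ ^ 2 - 2 * inner ℝ (X - Z) (Y - Z) + ‖X - Z‖ ^ 2 := by
    have : Y - X = (Y - Z) - (X - Z) := by abel
    rw [this, norm_sub_sq_real, real_inner_comm]
  rw [hYZ, norm_sub_rev Z X] at h2
  have h3 : ‖Y - Z‖ ^ 2 ≤ 0 := by linarith
  have h4 : ‖Y - Z‖ = 0 := by nlinarith [norm_nonneg (Y - Z)]
  exact sub_eq_zero.1 (norm_eq_zero.1 h4)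

/-! ### The operators `diag_B`, the variety `M_r` and its regular points -/

/-- The first standard unit vector of `ℝ^r`. -/
def e₁ (r : ℕ) : Fin r → ℝ := fun j => if (j : ℕ) = 0 then 1 else 0

/-- `diag_B (X) = (X_ii)_{i ∈ B}`. -/
def diagB {n : ℕ} (B : Finset (Fin n)) (X : Matrix (Fin n) (Fin n) ℝ) : B → ℝ :=
  fun i => X i i

/-- Extension of `μ ∈ ℝ^B` by zero to a vector in `ℝ^n`. -/
def extendB {n : ℕ} (B : Finset (Fin n)) (μ : B → ℝ) : Fin n → ℝ :=
  fun i => if h : i ∈ B then μ ⟨i, h⟩ else 0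

/-- The adjoint `diag_B^* (μ)`. -/
def diagBAdj {n : ℕ} (B : Finset (Fin n)) (μ : B → ℝ) : Matrix (Fin n) (Fin n) ℝ :=
  Matrix.diagonal (extendB B μ)

variable {m n : ℕ}

/-- `M_r = {R ∈ ℝ^{n × r} | A R = b e₁ᵀ, diag_B (R Rᵀ) = R_B e₁}`. -/
def variety (A : Matrix (Fin m) (Fin n) ℝ) (b : Fin m → ℝ) (B : Finset (Fin n)) (r : ℕ) :
    Set (Matrix (Fin n) (Fin r) ℝ) :=
  {R | A * R = vecMulVec b (e₁ r) ∧ diagB B (R * Rᵀ) = fun i : B => (R *ᵥ e₁ r) i}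

/-- The `m r + |B|` scalar functions whose common zero set is `M_r`. -/
def constraint (A : Matrix (Fin m) (Fin n) ℝ) (b : Fin m → ℝ) (B : Finset (Fin n)) (r : ℕ) :
    (Fin m × Fin r) ⊕ B → Matrix (Fin n) (Fin r) ℝ → ℝ
  | Sum.inl (k, j), R => (A * R) k j - b k * e₁ r j
  | Sum.inr i, R => (R * Rᵀ) i i - (R *ᵥ e₁ r) i

/-- Linear independence constraint qualification at `R`: the gradients at `R` of the scalar
constraint functions are linearly independent. -/
def LICQ (A : Matrix (Fin m) (Fin n) ℝ) (b : Fin m → ℝ) (B : Finset (Fin n)) {r : ℕ}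
    (R : Matrix (Fin n) (Fin r) ℝ) : Prop :=
  LinearIndependent ℝ fun k => gradient (constraint A b B r k) R

/-- The differential `h_R (H) = (A H ; 2 diag_B (H Rᵀ) - H_B e₁)` of the constraints. -/
def hMap (A : Matrix (Fin m) (Fin n) ℝ) (B : Finset (Fin n)) {r : ℕ}
    (R H : Matrix (Fin n) (Fin r) ℝ) : Matrix (Fin m) (Fin r) ℝ × (B → ℝ) :=
  (A * H, fun i => 2 * diagB B (H * Rᵀ) i - (H *ᵥ e₁ r) i)

/-- The adjoint `h_R^* (lam, μ) = Aᵀ lam + diag_B^* (μ) (2 R - e e₁ᵀ)`. -/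
def hAdj (A : Matrix (Fin m) (Fin n) ℝ) (B : Finset (Fin n)) {r : ℕ}
    (R : Matrix (Fin n) (Fin r) ℝ) (p : Matrix (Fin m) (Fin r) ℝ × (B → ℝ)) :
    Matrix (Fin n) (Fin r) ℝ :=
  Aᵀ * p.1 + diagBAdj B p.2 * ((2 : ℝ) • R - vecMulVec (fun _ => 1) (e₁ r))

/-- The tangent space `T_R M_r`. -/
def tangent (A : Matrix (Fin m) (Fin n) ℝ) (B : Finset (Fin n)) {r : ℕ}
    (R : Matrix (Fin n) (Fin r) ℝ) : Set (Matrix (Fin n) (Fin r) ℝ) :=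
  {H | hMap A B R H = 0}

/-- The metric-projection retraction `Rtr_R (H) = argmin {‖X - (R + H)‖² | X ∈ M_r}`,
as a set of minimizers. -/
def rtr (A : Matrix (Fin m) (Fin n) ℝ) (b : Fin m → ℝ) (B : Finset (Fin n)) {r : ℕ}
    (R H : Matrix (Fin n) (Fin r) ℝ) : Set (Matrix (Fin n) (Fin r) ℝ) :=
  metricProj (variety A b B r) (R + H)

/-- The matrix `[R, H]`, i.e. the columns of `H` appended to those of `R`. -/
def appendCols {r τ : ℕ} (R : Matrix (Fin n) (Fin r) ℝ) (H : Matrix (Fin n) (Fin τ) ℝ) :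
    Matrix (Fin n) (Fin (r + τ)) ℝ :=
  Matrix.of fun i => Fin.append (R i) (H i)

/-! ### The objective function

Symmetric matrices of order `n + 1` are indexed by `Unit ⊕ Fin n`, so that the block
decomposition `X = [X₁₁, X₁₂; X₂₁, X₂₂]` is the one of `Matrix.fromBlocks`. -/

/-- `R̂ = (e₁ᵀ ; R)`. -/
def hat {r : ℕ} (R : Matrix (Fin n) (Fin r) ℝ) : Matrix (Unit ⊕ Fin n) (Fin r) ℝ :=
  fromRows (replicateRow Unit (e₁ r)) R

/-- The cost matrix `C = [0, cᵀ; c, Q]`. -/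
def costC (Q : Matrix (Fin n) (Fin n) ℝ) (c : Fin n → ℝ) :
    Matrix (Unit ⊕ Fin n) (Unit ⊕ Fin n) ℝ :=
  fromBlocks 0 (replicateRow Unit c) (replicateCol Unit c) Q

/-- `φ (Y) = ⟪C, Y⟫ + (σ / 2) ‖Π_{K*} (σ⁻¹ Wt - Y)‖²`. -/
def phi (Q : Matrix (Fin n) (Fin n) ℝ) (c : Fin n → ℝ)
    (K : Set (Matrix (Unit ⊕ Fin n) (Unit ⊕ Fin n) ℝ)) (σ : ℝ)
    (Wt Y : Matrix (Unit ⊕ Fin n) (Unit ⊕ Fin n) ℝ) : ℝ :=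
  inner ℝ (costC Q c) Y + σ / 2 * ‖proj (dualCone K) (σ⁻¹ • Wt - Y)‖ ^ 2

/-- `f_r (R) = φ (R̂ R̂ᵀ)`. -/
def objective (Q : Matrix (Fin n) (Fin n) ℝ) (c : Fin n → ℝ)
    (K : Set (Matrix (Unit ⊕ Fin n) (Unit ⊕ Fin n) ℝ)) (σ : ℝ)
    (Wt : Matrix (Unit ⊕ Fin n) (Unit ⊕ Fin n) ℝ) {r : ℕ}
    (R : Matrix (Fin n) (Fin r) ℝ) : ℝ :=
  phi Q c K σ Wt (hat R * (hat R)ᵀ)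

/-! ### Dual variables -/

/-- `W = σ Π_{K*} (σ⁻¹ Wt - R̂ R̂ᵀ)`. -/
def dualW (K : Set (Matrix (Unit ⊕ Fin n) (Unit ⊕ Fin n) ℝ)) (σ : ℝ)
    (Wt : Matrix (Unit ⊕ Fin n) (Unit ⊕ Fin n) ℝ) {r : ℕ}
    (R : Matrix (Fin n) (Fin r) ℝ) : Matrix (Unit ⊕ Fin n) (Unit ⊕ Fin n) ℝ :=
  σ • proj (dualCone K) (σ⁻¹ • Wt - hat R * (hat R)ᵀ)

/-- `L = Q - diag_B^* (μ) - W₂₂`. -/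
def dualL (Q : Matrix (Fin n) (Fin n) ℝ) (B : Finset (Fin n))
    (W : Matrix (Unit ⊕ Fin n) (Unit ⊕ Fin n) ℝ) (μ : B → ℝ) : Matrix (Fin n) (Fin n) ℝ :=
  Q - diagBAdj B μ - W.toBlocks₂₂

/-- `q = 2 c + diag_B^* (μ) e - 2 W₂₁`. -/
def dualq (c : Fin n → ℝ) (B : Finset (Fin n))
    (W : Matrix (Unit ⊕ Fin n) (Unit ⊕ Fin n) ℝ) (μ : B → ℝ) : Fin n → ℝ :=
  fun i => 2 * c i + extendB B μ i - 2 * W.toBlocks₂₁ i ()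

/-- `(R; lam, μ)` satisfies the KKT conditions of `min {f_r (R) | R ∈ M_r}`:
`2 L R + q e₁ᵀ - Aᵀ lam = 0` and `R ∈ M_r`. -/
def IsKKT (Q : Matrix (Fin n) (Fin n) ℝ) (c : Fin n → ℝ) (A : Matrix (Fin m) (Fin n) ℝ)
    (b : Fin m → ℝ) (B : Finset (Fin n))
    (K : Set (Matrix (Unit ⊕ Fin n) (Unit ⊕ Fin n) ℝ)) (σ : ℝ)
    (Wt : Matrix (Unit ⊕ Fin n) (Unit ⊕ Fin n) ℝ) {r : ℕ}
    (R : Matrix (Fin n) (Fin r) ℝ) (lam : Matrix (Fin m) (Fin r) ℝ) (μ : B → ℝ) : Prop :=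
  (2 : ℝ) • (dualL Q B (dualW K σ Wt R) μ * R)
      + vecMulVec (dualq c B (dualW K σ Wt R) μ) (e₁ r) - Aᵀ * lam = 0 ∧
    R ∈ variety A b B r

/-- `A† = Aᵀ (A Aᵀ)⁻¹`. -/
def pinv (A : Matrix (Fin m) (Fin n) ℝ) : Matrix (Fin n) (Fin m) ℝ := Aᵀ * (A * Aᵀ)⁻¹

/-- `J_A = I - A† A`. -/
def projJ (A : Matrix (Fin m) (Fin n) ℝ) : Matrix (Fin n) (Fin n) ℝ := 1 - pinv A * A

/-- `y = (lam₁ ; vec (lam₂) ; μ ; α)`, with `lam₂` kept as a matrix. -/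
abbrev DualSpace (m n : ℕ) (B : Finset (Fin n)) : Type :=
  (Fin m → ℝ) × Matrix (Fin m) (Fin n) ℝ × (B → ℝ) × ℝ

/-- `𝒜 (Y) = (A Y₂₁ ; A Y₂₂ - b Y₁₂ ; diag_B (Y₂₂) - (Y₂₁)_B ; Y₁₁)`. -/
def opA (A : Matrix (Fin m) (Fin n) ℝ) (b : Fin m → ℝ) (B : Finset (Fin n))
    (Y : Matrix (Unit ⊕ Fin n) (Unit ⊕ Fin n) ℝ) : DualSpace m n B :=
  (A *ᵥ fun i => Y.toBlocks₂₁ i (),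
   A * Y.toBlocks₂₂ - vecMulVec b (Y.toBlocks₁₂ ()),
   fun i => diagB B Y.toBlocks₂₂ i - Y.toBlocks₂₁ i (),
   Y.toBlocks₁₁ () ())

/-- The vector `(Aᵀ lam₁ - lam₂ᵀ b - diag_B^* (μ) e) / 2`. -/
def opAAdjCol (A : Matrix (Fin m) (Fin n) ℝ) (b : Fin m → ℝ) (B : Finset (Fin n))
    (y : DualSpace m n B) : Fin n → ℝ :=
  (1 / 2 : ℝ) • (Aᵀ *ᵥ y.1 - y.2.1ᵀ *ᵥ b - extendB B y.2.2.1)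

/-- The adjoint `𝒜^*` with respect to the trace inner product on symmetric matrices
(see `opAAdj_isSymm` and `inner_opAAdj`, which characterize it). -/
def opAAdj (A : Matrix (Fin m) (Fin n) ℝ) (b : Fin m → ℝ) (B : Finset (Fin n))
    (y : DualSpace m n B) : Matrix (Unit ⊕ Fin n) (Unit ⊕ Fin n) ℝ :=
  fromBlocks (Matrix.of fun _ _ => y.2.2.2) (replicateRow Unit (opAAdjCol A b B y))
    (replicateCol Unit (opAAdjCol A b B y))
    ((1 / 2 : ℝ) • (Aᵀ * y.2.1 + y.2.1ᵀ * A) + diagBAdj B y.2.2.1)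

theorem opAAdj_isSymm (A : Matrix (Fin m) (Fin n) ℝ) (b : Fin m → ℝ) (B : Finset (Fin n))
    (y : DualSpace m n B) : (opAAdj A b B y).IsSymm := by
  unfold opAAdj
  refine Matrix.IsSymm.fromBlocks ?_ ?_ ?_
  · ext; rfl
  · ext; rfl
  · simp [Matrix.IsSymm, diagBAdj, add_comm]

theorem sum_extendB (B : Finset (Fin n)) (μ : B → ℝ) (v : Fin n → ℝ) :
    ∑ i, extendB B μ i * v i = ∑ i : B, μ i * v i := by
  rw [← Finset.sum_subset (Finset.subset_univ B), ← Finset.sum_coe_sort]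
  · exact Finset.sum_congr rfl fun i _ => by simp [extendB]
  · intro i _ hi; simp [extendB, hi]

theorem inner_opAAdj (A : Matrix (Fin m) (Fin n) ℝ) (b : Fin m → ℝ) (B : Finset (Fin n))
    (y : DualSpace m n B) (Y : Matrix (Unit ⊕ Fin n) (Unit ⊕ Fin n) ℝ) (hY : Y.IsSymm) :
    inner ℝ (opAAdj A b B y) Y =
      y.1 ⬝ᵥ (opA A b B Y).1 + inner ℝ y.2.1 (opA A b B Y).2.1
        + y.2.2.1 ⬝ᵥ (opA A b B Y).2.2.1 + y.2.2.2 * (opA A b B Y).2.2.2 := by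
  obtain ⟨l₁, l₂, μ, α⟩ := y
  set X := Y.toBlocks₂₂ with hX
  set x : Fin n → ℝ := fun i => Y.toBlocks₂₁ i () with hx
  have hXs : Xᵀ = X := by
    ext i j; exact congrFun (congrFun hY (Sum.inr i)) (Sum.inr j)
  have hx' : Y.toBlocks₁₂ () = x := by
    ext i; exact (congrFun (congrFun hY (Sum.inl ())) (Sum.inr i)).symm
  have e0 : inner ℝ (opAAdj A b B (l₁, l₂, μ, α)) Y =
      α * Y.toBlocks₁₁ () () + 2 * (opAAdjCol A b B (l₁, l₂, μ, α) ⬝ᵥ x) +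
        inner ℝ ((1 / 2 : ℝ) • (Aᵀ * l₂ + l₂ᵀ * A) + diagBAdj B μ) X := by
    have h12 : ∀ i, Y (Sum.inl ()) (Sum.inr i) = x i := fun i => congrFun hx' i
    simp only [inner_def, trace, diag, mul_apply, opAAdj, Fintype.sum_sum_type, dotProduct,
      transpose_apply, fromBlocks_apply₁₁, fromBlocks_apply₁₂, fromBlocks_apply₂₁,
      fromBlocks_apply₂₂, Finset.univ_unique, Finset.sum_singleton, h12,
      replicateRow_apply, replicateCol_apply, Finset.sum_add_distrib]
    simp only [hX, hx, toBlocks₁₁, toBlocks₂₁, toBlocks₂₂, of_apply]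
    simp only [PUnit.default_eq_unit]
    ring
  have e1 : inner ℝ (Aᵀ * l₂) X = inner ℝ l₂ (A * X) := by
    rw [inner_def, inner_def, transpose_mul, Matrix.mul_assoc, trace_mul_comm, Matrix.mul_assoc]
  have e2 : inner ℝ (l₂ᵀ * A) X = inner ℝ l₂ (A * X) := by
    rw [← e1, inner_def, inner_def, ← trace_transpose, transpose_mul, transpose_mul,
      transpose_transpose, transpose_transpose, hXs, trace_mul_comm]
  have e3 : inner ℝ (diagBAdj B μ) X = μ ⬝ᵥ diagB B X := by
    rw [inner_def, hXs]
    simp only [trace, diag, diagBAdj, diagonal_mul, sum_extendB, dotProduct, diagB]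
  have e4 : (Aᵀ *ᵥ l₁) ⬝ᵥ x = l₁ ⬝ᵥ (A *ᵥ x) := by
    rw [mulVec_transpose, dotProduct_mulVec]
  have e5 : (l₂ᵀ *ᵥ b) ⬝ᵥ x = inner ℝ l₂ (vecMulVec b x) := by
    rw [inner_def]
    simp only [dotProduct, mulVec, transpose_apply, trace, diag, mul_apply, vecMulVec_apply,
      Finset.sum_mul]
    rw [Finset.sum_comm]
    exact Finset.sum_congr rfl fun i _ => Finset.sum_congr rfl fun j _ => by ring
  have e6 : extendB B μ ⬝ᵥ x = μ ⬝ᵥ fun i : B => x i := sum_extendB B μ x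
  have e7 : (fun i : B => diagB B X i - x i) = diagB B X - fun i : B => x i := rfl
  rw [e0]
  simp only [opA, opAAdjCol]
  rw [← hX, ← hx, hx', e7]
  simp only [inner_add_left, inner_smul_left, e1, e2, e3, smul_dotProduct, sub_dotProduct, e4,
    e5, e6, dotProduct_sub, inner_sub_right, smul_eq_mul, RCLike.conj_to_real]
  ring

/-- The matrix `S = C - 𝒜^* (y) - W` recovered from a KKT point `(R; lam, μ)`, where
`y = (lam₁ ; vec (lam₂) ; μ ; α)` with `lam₁ = (A†)ᵀ (q + L A† b)`,
`lam₂ = (A†)ᵀ L (2 I - A† A)` and `α = -(J_A R e₁)ᵀ L (J_A R e₁) - W₁₁`. -/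
def recoveredS (Q : Matrix (Fin n) (Fin n) ℝ) (c : Fin n → ℝ) (A : Matrix (Fin m) (Fin n) ℝ)
    (b : Fin m → ℝ) (B : Finset (Fin n))
    (K : Set (Matrix (Unit ⊕ Fin n) (Unit ⊕ Fin n) ℝ)) (σ : ℝ)
    (Wt : Matrix (Unit ⊕ Fin n) (Unit ⊕ Fin n) ℝ) {r : ℕ}
    (R : Matrix (Fin n) (Fin r) ℝ) (μ : B → ℝ) : Matrix (Unit ⊕ Fin n) (Unit ⊕ Fin n) ℝ :=
  let W := dualW K σ Wt R
  let L := dualL Q B W μ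
  let q := dualq c B W μ
  let lam₁ : Fin m → ℝ := (pinv A)ᵀ *ᵥ (q + L *ᵥ (pinv A *ᵥ b))
  let lam₂ : Matrix (Fin m) (Fin n) ℝ := (pinv A)ᵀ * L * ((2 : ℝ) • 1 - pinv A * A)
  let v : Fin n → ℝ := projJ A *ᵥ (R *ᵥ e₁ r)
  let α : ℝ := -(v ⬝ᵥ (L *ᵥ v)) - W.toBlocks₁₁ () ()
  costC Q c - opAAdj A b B (lam₁, lam₂, μ, α) - W

/-- The `n × (n + 1)` matrix `J_A (-R e₁, I)`. -/
def escapeMap (A : Matrix (Fin m) (Fin n) ℝ) {r : ℕ} (R : Matrix (Fin n) (Fin r) ℝ) :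
    Matrix (Fin n) (Unit ⊕ Fin n) ℝ :=
  projJ A * fromCols (replicateCol Unit (-(R *ᵥ e₁ r))) 1

end

end RNNAL

open RNNAL

/-! The objective is `φ(R̂R̂ᵀ)`, and `φ` is differentiable with Lipschitz gradient but need not be
twice differentiable, so a second-order Taylor expansion along the retraction is not available. What
replaces it is that a rank-raising direction `U = [0, H]` has columns disjoint from those of `P =
[R, 0]`: the cross product of `P̂` with `(0; U)` vanishes, so a step of length `t` changes `R̂R̂ᵀ`
only by `O(t²)`. The quadratic remainder of `φ` is then `O(t⁴)` (`abs_objective_add_sub_le`,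
`hat_appendCols_mul_hatVar`), and only the exactly computable term `⟪C - W, ΔY⟫` matters.

Write the retracted point as `P + E` with `E = tU + D`. The constraints are quadratic and hold at
both ends, so `⟪h*(λ,μ), E⟫ = -⟪diag*(μ) E, E⟫`, and the change of the objective becomes `⟪T, E⟫ +
⟪LE, E⟫` up to the remainder, where `T = ∇f - h*(λ,μ)` (`abs_objective_sub_le_of_feasible`). The
normal equation makes `T` tangent, and `T` is orthogonal to `U`, so only `⟪T, D⟫` survives.

It remains to control `D` (`exists_nearest_curve`). The Lagrange condition at a nearest point `Z`
says that `D` is a combination of constraint gradients at `Z`, with coefficients bounded by a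
multiple of `‖D‖`. Pairing `D` with those gradients gives `D = O(t²)`; tangent vectors at `P` are
almost orthogonal to them, so `⟪T, D⟫ = O(t³)`; and small coefficients force uniqueness. Hence the
change is `t²⟪L, HHᵀ⟫ + O(t³)`.

For the escape direction, the KKT equation turns the recovered matrix into `S = GᵀLG` with `G =
J_A(-Re₁, I)` (`IsKKT.recoveredS_eq`). With `H = GV` the coefficient is `⟪S, VVᵀ⟫`, a sum of
negative eigenvalues times squared lengths. -/

section NearestPoints

/-! ### Nearest points of regular constraint sets. -/

variable {E ι : Type*} [NormedAddCommGroup E] [InnerProductSpace ℝ E] [Fintype ι]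
  {g : ι → E → ℝ} {G : ι → E → E} {C : ℝ}

theorem norm_sum_smul_le_of_norm_le (ν : ι → ℝ) (v : ι → E) {M : ℝ} (hv : ∀ k, ‖v k‖ ≤ M) :
    ‖∑ k, ν k • v k‖ ≤ Fintype.card ι * (‖ν‖ * M) := by
  have h : ∀ k ∈ Finset.univ, ‖ν k • v k‖ ≤ ‖ν‖ * M := fun k _ => by
    rw [norm_smul]
    exact mul_le_mul (norm_le_pi_norm ν k) (hv k) (norm_nonneg _) (norm_nonneg _)
  simpa [nsmul_eq_mul] using norm_sum_le_of_le _ h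

theorem abs_sum_mul_le_of_abs_le (ν : ι → ℝ) (v : ι → ℝ) {M : ℝ} (hv : ∀ k, |v k| ≤ M) :
    |∑ k, ν k * v k| ≤ Fintype.card ι * (‖ν‖ * M) :=
  norm_sum_smul_le_of_norm_le ν v hv

/-- If the gradients `G k` are Lipschitz and linearly independent at `P`, the coefficients of a
linear combination of the gradients are bounded by its norm, uniformly near `P`. -/
theorem exists_bound_coeff_of_linearIndependent (hC : 0 ≤ C)
    (hG : ∀ k x y, ‖G k y - G k x‖ ≤ C * ‖y - x‖) {P : E}
    (hP : LinearIndependent ℝ fun k => G k P) :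
    ∃ κ > 0, ∃ δ > 0, ∀ Z, ‖Z - P‖ ≤ δ → ∀ ν : ι → ℝ, ‖ν‖ ≤ κ * ‖∑ k, ν k • G k Z‖ := by
  have hker : LinearMap.ker (Fintype.linearCombination ℝ fun k => G k P) = ⊥ := by
    rw [LinearMap.ker_eq_bot']
    intro ν hν
    rw [Fintype.linearCombination_apply] at hν
    exact funext (Fintype.linearIndependent_iff.1 hP ν hν)
  obtain ⟨K, hK, hanti⟩ := LinearMap.exists_antilipschitzWith _ hker
  have hK' : (0 : ℝ) < K := hK
  set N : ℝ := (Fintype.card ι : ℝ) with hN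
  have hN0 : 0 ≤ N := Nat.cast_nonneg _
  -- On this ball, replacing `G k P` by `G k Z` costs at most `‖ν‖ / 2`, which is absorbed by
  -- doubling the constant; the `+ 1` keeps the denominator positive.
  refine ⟨2 * K, by positivity, 1 / (2 * K * (N * C + 1)), by positivity, fun Z hZ ν => ?_⟩
  have h1 : ‖ν‖ ≤ K * ‖∑ k, ν k • G k P‖ := by
    have := hanti.le_mul_dist ν 0
    simpa [Fintype.linearCombination_apply] using this
  have h2 : ‖∑ k, ν k • (G k Z - G k P)‖ ≤ N * (‖ν‖ * (C * ‖Z - P‖)) :=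
    norm_sum_smul_le_of_norm_le ν _ fun k => hG k P Z
  have h3 : ∑ k, ν k • G k P = ∑ k, ν k • G k Z - ∑ k, ν k • (G k Z - G k P) := by
    simp [smul_sub]
  have h4 : ‖∑ k, ν k • G k P‖ ≤ ‖∑ k, ν k • G k Z‖ + N * (‖ν‖ * (C * ‖Z - P‖)) := by
    rw [h3]; exact (norm_sub_le _ _).trans (by gcongr)
  have h5 : ‖Z - P‖ * (2 * K * (N * C + 1)) ≤ 1 := by
    rwa [le_div_iff₀ (by positivity)] at hZ
  have h6 : K * (N * (‖ν‖ * (C * ‖Z - P‖))) ≤ ‖ν‖ / 2 := by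
    have : 2 * K * (N * C) * ‖Z - P‖ ≤ 1 := by nlinarith [norm_nonneg (Z - P)]
    nlinarith [norm_nonneg ν]
  nlinarith

/-- A uniform quadratic remainder with Lipschitz gradient gives the strict differentiability that
the Lagrange multiplier theorem asks for. -/
theorem hasStrictFDerivAt_of_quadratic_bound
    {φ : E → ℝ} {Φ : E → E} {C : ℝ}
    (hφ : ∀ x y, |φ y - φ x - inner ℝ (Φ x) (y - x)| ≤ C * ‖y - x‖ ^ 2)
    (hΦ : ∀ x y, ‖Φ y - Φ x‖ ≤ C * ‖y - x‖) (x : E) :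
    HasStrictFDerivAt φ (innerSL ℝ (Φ x)) x := by
  rw [hasStrictFDerivAt_iff_isLittleO]
  have hbd : ∀ p : E × E, ‖φ p.1 - φ p.2 - innerSL ℝ (Φ x) (p.1 - p.2)‖
      ≤ ‖(C * ‖p.1 - p.2‖ + C * ‖p.2 - x‖) * ‖p.1 - p.2‖‖ := by
    -- Expand at `p.2`, then move the gradient from `p.2` to `x` by the Lipschitz bound.
    intro p
    have h1 := hφ p.2 p.1
    have h2 : |inner ℝ (Φ p.2 - Φ x) (p.1 - p.2)| ≤ C * ‖p.2 - x‖ * ‖p.1 - p.2‖ :=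
      (abs_real_inner_le_norm _ _).trans (by gcongr; exact hΦ _ _)
    have h3 : φ p.1 - φ p.2 - innerSL ℝ (Φ x) (p.1 - p.2) =
        (φ p.1 - φ p.2 - inner ℝ (Φ p.2) (p.1 - p.2)) + inner ℝ (Φ p.2 - Φ x) (p.1 - p.2) := by
      rw [inner_sub_left, innerSL_apply_apply]; ring
    rw [h3, Real.norm_eq_abs]
    refine (abs_add_le _ _).trans (le_trans ?_ (le_abs_self _))
    nlinarith
  refine (IsBigO.of_bound' (Eventually.of_forall hbd)).trans_isLittleO ?_
  have ht : Tendsto (fun p : E × E => C * ‖p.1 - p.2‖ + C * ‖p.2 - x‖) (𝓝 (x, x)) (𝓝 0) := by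
    have : Continuous fun p : E × E => C * ‖p.1 - p.2‖ + C * ‖p.2 - x‖ := by fun_prop
    simpa using this.tendsto (x, x)
  have h := ((isLittleO_one_iff ℝ).2 ht).mul_isBigO
    (isBigO_refl (fun p : E × E => ‖p.1 - p.2‖) (𝓝 (x, x)))
  simp only [one_mul] at h
  exact h.of_norm_right

/-- At a nearest point `Z` of a regular constraint set, the residual is normal to the set. -/
theorem exists_multipliers_of_nearest [CompleteSpace E]
    (hg : ∀ k x y, |g k y - g k x - inner ℝ (G k x) (y - x)| ≤ C * ‖y - x‖ ^ 2)
    (hG : ∀ k x y, ‖G k y - G k x‖ ≤ C * ‖y - x‖) {X Z : E}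
    (hZ : LinearIndependent ℝ fun k => G k Z) (hZM : ∀ k, g k Z = 0)
    (hmin : ∀ Y, (∀ k, g k Y = 0) → ‖Z - X‖ ≤ ‖Y - X‖) :
    ∃ ν : ι → ℝ, Z - X = ∑ k, ν k • G k Z := by
  have hext : IsLocalExtrOn (fun Y => ‖Y - X‖ ^ 2) {Y | ∀ k, g k Y = g k Z} Z := by
    refine Or.inl (IsMinOn.localize fun Y hY => ?_)
    have := hmin Y fun k => (hY k).trans (hZM k)
    change ‖Z - X‖ ^ 2 ≤ ‖Y - X‖ ^ 2
    gcongr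
  have hsq : HasStrictFDerivAt (fun Y => ‖Y - X‖ ^ 2) (innerSL ℝ ((2 : ℝ) • (Z - X))) Z := by
    refine hasStrictFDerivAt_of_quadratic_bound (Φ := fun Y => (2 : ℝ) • (Y - X)) (C := 2) ?_ ?_ Z
    · intro x y
      have : y - X = (x - X) + (y - x) := by abel
      rw [this, norm_add_sq_real, inner_smul_left]
      simp only [RCLike.conj_to_real]
      rw [show ∀ a b c : ℝ, a + 2 * b + c ^ 2 - a - 2 * b = c ^ 2 by intros; ring,
        abs_of_nonneg (by positivity)]
      nlinarith [sq_nonneg ‖y - x‖]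
    · intro x y
      rw [← smul_sub, norm_smul]; simp
  obtain ⟨Λ, Λ₀, h0, hsum⟩ := hext.exists_multipliers_of_hasStrictFDerivAt
    (fun k => hasStrictFDerivAt_of_quadratic_bound (hg k) (hG k) Z) hsq
  have hvec : ∑ k, Λ k • G k Z + Λ₀ • ((2 : ℝ) • (Z - X)) = 0 := by
    refine ext_inner_right ℝ fun v => ?_
    have := congrArg (fun f : StrongDual ℝ E => f v) hsum
    simpa [sum_inner, inner_add_left, inner_smul_left, inner_sub_left] using this
  -- If the multiplier of the distance vanished, the constraint gradients at `Z` would be dependent.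
  have hΛ₀ : Λ₀ ≠ 0 := by
    rintro rfl
    refine h0 (Prod.ext (funext (Fintype.linearIndependent_iff.1 hZ Λ ?_)) rfl)
    simpa using hvec
  refine ⟨fun k => -(2 * Λ₀)⁻¹ * Λ k, ?_⟩
  simp only [mul_smul, ← Finset.smul_sum]
  rw [eq_neg_of_add_eq_zero_left hvec, smul_smul, smul_neg, neg_smul, neg_neg, smul_smul,
    inv_mul_eq_div, show Λ₀ * 2 = 2 * Λ₀ by ring, div_self (by simpa using hΛ₀), one_smul]

/-- The metric projection of `P + t U` onto a regular constraint set, for `U` tangent at `P`: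
it is a single point for small `t`, it differs from `P + t U` by `O (t²)`, and the component of the
difference along the tangent space at `P` is `O (t³)`. -/
theorem exists_nearest_curve [FiniteDimensional ℝ E] (hC : 0 ≤ C)
    (hg : ∀ k x y, |g k y - g k x - inner ℝ (G k x) (y - x)| ≤ C * ‖y - x‖ ^ 2)
    (hG : ∀ k x y, ‖G k y - G k x‖ ≤ C * ‖y - x‖) {P U : E}
    (hP : LinearIndependent ℝ fun k => G k P) (hPM : ∀ k, g k P = 0)
    (hU : ∀ k, inner ℝ (G k P) U = 0) :
    ∃ (ρ : ℝ → E) (K : ℝ), ∀ᶠ t : ℝ in 𝓝 0,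
      {Z | (∀ k, g k Z = 0) ∧ ∀ Y, (∀ k, g k Y = 0) →
        ‖Z - (P + t • U)‖ ≤ ‖Y - (P + t • U)‖} = {ρ t} ∧
      ‖ρ t - (P + t • U)‖ ≤ K * t ^ 2 ∧
      ∀ T, (∀ k, inner ℝ (G k P) T = 0) →
        |inner ℝ T (ρ t - (P + t • U))| ≤ K * ‖T‖ * |t| ^ 3 := by
  obtain ⟨κ, hκ, δ, hδ, hbd⟩ := exists_bound_coeff_of_linearIndependent hC hG hP
  set N : ℝ := (Fintype.card ι : ℝ) with hN
  have hN0 : 0 ≤ N := Nat.cast_nonneg _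
  set a := ‖U‖ with ha
  have ha0 : 0 ≤ a := norm_nonneg _
  set S : ℝ → Set E := fun t => {Z | (∀ k, g k Z = 0) ∧ ∀ Y, (∀ k, g k Y = 0) →
        ‖Z - (P + t • U)‖ ≤ ‖Y - (P + t • U)‖} with hS
  have hcont : ∀ k, Continuous (g k) := fun k => continuous_iff_continuousAt.2 fun x =>
    (hasStrictFDerivAt_of_quadratic_bound (hg k) (hG k) x).hasFDerivAt.continuousAt
  have hclosed : IsClosed {Z | ∀ k, g k Z = 0} := by
    rw [Set.ofPred_forall]
    exact isClosed_iInter fun k => isClosed_eq (hcont k) continuous_const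
  have hne : ∀ t, (S t).Nonempty := fun t => by
    obtain ⟨Z, hZ, hZd⟩ := hclosed.exists_infDist_eq_dist ⟨P, hPM⟩ (P + t • U)
    refine ⟨Z, hZ, fun Y hY => ?_⟩
    rw [← dist_eq_norm, ← dist_eq_norm, dist_comm Z, dist_comm Y, ← hZd]
    exact Metric.infDist_le_dist_of_mem hY
  have htU : ∀ t : ℝ, ‖t • U‖ = |t| * a := fun t => by rw [norm_smul, Real.norm_eq_abs]
  -- The feasible point `P` itself is a competitor, at distance `‖t U‖`.
  have hclose : ∀ t, ∀ Z ∈ S t, ‖Z - (P + t • U)‖ ≤ |t| * a := fun t Z hZ => by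
    simpa [htU] using hZ.2 P hPM
  have hcloseP : ∀ t, ∀ Z ∈ S t, ‖Z - P‖ ≤ 2 * a * |t| := fun t Z hZ => by
    have h : Z - P = (Z - (P + t • U)) + t • U := by abel
    rw [h]
    refine (norm_add_le _ _).trans ?_
    rw [htU]; linarith [hclose t Z hZ]
  have hnormal : ∀ t : ℝ, 2 * a * |t| ≤ δ → ∀ Z ∈ S t, ∃ ν : ι → ℝ,
      Z - (P + t • U) = ∑ k, ν k • G k Z ∧ ‖ν‖ ≤ κ * ‖Z - (P + t • U)‖ := by
    intro t ht Z hZ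
    have hb := hbd Z ((hcloseP t Z hZ).trans ht)
    -- The coefficient bound at `Z` already contains linear independence there.
    have hli : LinearIndependent ℝ fun k => G k Z :=
      Fintype.linearIndependent_iff.2 fun ν hν k => by
        have := hb ν
        rw [hν, norm_zero, mul_zero] at this
        simpa using congrFun (norm_le_zero_iff.1 this) k
    obtain ⟨ν, hν⟩ := exists_multipliers_of_nearest hg hG hli hZ.1 hZ.2
    exact ⟨ν, hν, by rw [hν]; exact hb ν⟩
  -- The `6` is `4 + 2`: `4` from the remainder at `‖P - Z‖ ≤ 2a|t|`, `2` from turning the gradient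
  -- between `P` and `Z` and pairing it with `tU`.
  set K₁ : ℝ := N * (κ * (6 * C * a ^ 2)) with hK₁
  set K₂ : ℝ := N * (κ * K₁ * (2 * C * a)) with hK₂
  have hK₁0 : 0 ≤ K₁ := by positivity
  have hK₂0 : 0 ≤ K₂ := by positivity
  refine ⟨fun t => (hne t).some, K₁ + K₂, ?_⟩
  have hev1 : ∀ᶠ t : ℝ in 𝓝 0, 2 * a * |t| < δ := by
    have : Tendsto (fun t : ℝ => 2 * a * |t|) (𝓝 0) (𝓝 0) := by
      have h : Continuous fun t : ℝ => 2 * a * |t| := by fun_prop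
      simpa using h.tendsto 0
    exact this.eventually (gt_mem_nhds hδ)
  have hev2 : ∀ᶠ t : ℝ in 𝓝 0, 2 * (N * (κ * a * C)) * |t| < 1 := by
    have : Tendsto (fun t : ℝ => 2 * (N * (κ * a * C)) * |t|) (𝓝 0) (𝓝 0) := by
      have h : Continuous fun t : ℝ => 2 * (N * (κ * a * C)) * |t| := by fun_prop
      simpa using h.tendsto 0
    exact this.eventually (gt_mem_nhds one_pos)
  filter_upwards [hev1, hev2] with t ht1 ht2
  have hspec : (hne t).some ∈ S t := (hne t).some_mem
  set Z := (hne t).some with hZ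
  obtain ⟨ν, hν, hνb⟩ := hnormal t ht1.le Z hspec
  set D := Z - (P + t • U) with hD
  have hGZ : ∀ k, ‖G k Z - G k P‖ ≤ C * (2 * a * |t|) := fun k =>
    (hG k P Z).trans (by gcongr; exact hcloseP t Z hspec)
  have hDb : ‖D‖ ≤ K₁ * t ^ 2 := by
    have hk : ∀ k, |inner ℝ (G k Z) D| ≤ 6 * C * a ^ 2 * t ^ 2 := fun k => by
      -- Both `P` and `Z` are feasible and `U` is tangent at `P`, so only second-order terms remain.
      have e1 : inner ℝ (G k Z) D =
          (g k P - g k Z - inner ℝ (G k Z) (P - Z)) - t * inner ℝ (G k Z - G k P) U := by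
        have : D = -(P - Z) - t • U := by rw [hD]; abel
        rw [this, inner_sub_right, inner_neg_right, inner_smul_right, inner_sub_left, hU k, hPM k,
          hspec.1 k]
        ring
      have e2 := hg k Z P
      have e3 : ‖P - Z‖ ^ 2 ≤ (2 * a * |t|) ^ 2 := by
        rw [norm_sub_rev]; gcongr; exact hcloseP t Z hspec
      have e4 : |inner ℝ (G k Z - G k P) U| ≤ C * (2 * a * |t|) * a :=
        (abs_real_inner_le_norm _ _).trans (by gcongr; exact hGZ k)
      have e5 : |t * inner ℝ (G k Z - G k P) U| ≤ |t| * (C * (2 * a * |t|) * a) := by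
        rw [abs_mul]; gcongr
      have e6 : |t| ^ 2 = t ^ 2 := sq_abs t
      rw [e1]
      refine (abs_sub _ _).trans ?_
      have e7 : C * ‖P - Z‖ ^ 2 ≤ C * (2 * a * |t|) ^ 2 := by gcongr
      have e8 : C * (2 * a * |t|) ^ 2 + |t| * (C * (2 * a * |t|) * a)
          = 6 * C * a ^ 2 * t ^ 2 := by rw [← e6]; ring
      linarith
    -- Substituting the normal representation for one factor `D` makes the right side `O(‖D‖ t²)`;
    -- one factor `‖D‖` then cancels.
    have h1 : ‖D‖ ^ 2 = ∑ k, ν k * inner ℝ (G k Z) D := by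
      rw [← real_inner_self_eq_norm_sq]
      conv_lhs => rw [hν]
      rw [sum_inner]
      simp only [inner_smul_left, RCLike.conj_to_real, ← hν]
    have h2 := abs_sum_mul_le_of_abs_le ν _ hk
    rw [← h1, abs_of_nonneg (by positivity)] at h2
    have h3 : N * (‖ν‖ * (6 * C * a ^ 2 * t ^ 2)) ≤
        N * (κ * ‖D‖ * (6 * C * a ^ 2 * t ^ 2)) := by gcongr
    rcases (norm_nonneg D).eq_or_lt with h0 | h0
    · rw [← h0]; positivity
    · refine le_of_mul_le_mul_right ?_ h0
      rw [hK₁]; nlinarith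
  refine ⟨?_, hDb.trans (by gcongr; linarith), fun T hT => ?_⟩
  -- For a second minimizer `Y`, equal distances give `2⟪D, Y - Z⟫ + ‖Y - Z‖² = 0`. Feasibility
  -- makes the inner product `O(|t|) ‖Y - Z‖²`, which cannot balance the square once `t` is small.
  · refine Set.eq_singleton_iff_unique_mem.2 ⟨hspec, fun Y hY => ?_⟩
    have hdist : ‖Y - (P + t • U)‖ = ‖D‖ := le_antisymm (hY.2 Z hspec.1) (hspec.2 Y hY.1)
    have e1 : ‖Y - (P + t • U)‖ ^ 2 = ‖D‖ ^ 2 + 2 * inner ℝ D (Y - Z) + ‖Y - Z‖ ^ 2 := by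
      rw [← norm_add_sq_real]; congr 2; rw [hD]; abel
    rw [hdist] at e1
    have e2 : inner ℝ D (Y - Z) = ∑ k, ν k * inner ℝ (G k Z) (Y - Z) := by
      conv_lhs => rw [hν]
      rw [sum_inner]
      simp only [inner_smul_left, RCLike.conj_to_real]
    have e3 : |inner ℝ D (Y - Z)| ≤ N * (‖ν‖ * (C * ‖Y - Z‖ ^ 2)) := by
      rw [e2]
      refine abs_sum_mul_le_of_abs_le ν _ fun k => ?_
      have := hg k Z Y
      rwa [hspec.1 k, hY.1 k, sub_zero, zero_sub, abs_neg] at this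
    have e4 : N * (‖ν‖ * (C * ‖Y - Z‖ ^ 2)) ≤ N * ((κ * (|t| * a)) * (C * ‖Y - Z‖ ^ 2)) := by
      gcongr
      exact hνb.trans (by gcongr; exact hclose t Z hspec)
    have e5 := neg_abs_le (inner ℝ D (Y - Z))
    have e6 : ‖Y - Z‖ ^ 2 * (1 - 2 * (N * (κ * a * C)) * |t|) ≤ 0 := by nlinarith
    have e7 : ‖Y - Z‖ ^ 2 ≤ 0 := by
      by_contra! h
      nlinarith [mul_pos h (sub_pos.2 ht2)]
    have e8 : ‖Y - Z‖ = 0 := by nlinarith [norm_nonneg (Y - Z)]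
    exact sub_eq_zero.1 (norm_eq_zero.1 e8)
  -- Tangency of `T` at `P` lets `G k P` be subtracted: a factor `O(t²)` from `ν` and `O(t)` from
  -- the turning of the gradients.
  · have e1 : inner ℝ T D = ∑ k, ν k * inner ℝ (G k Z - G k P) T := by
      conv_lhs => rw [real_inner_comm, hν]
      rw [sum_inner]
      simp only [inner_smul_left, RCLike.conj_to_real, inner_sub_left, hT, sub_zero]
    have e2 : |inner ℝ T D| ≤ N * (‖ν‖ * (C * (2 * a * |t|) * ‖T‖)) := by
      rw [e1]
      exact abs_sum_mul_le_of_abs_le ν _ fun k =>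
        (abs_real_inner_le_norm _ _).trans (by gcongr; exact hGZ k)
    have e3 : ‖ν‖ ≤ κ * (K₁ * t ^ 2) := hνb.trans (by gcongr)
    have e4 : N * (‖ν‖ * (C * (2 * a * |t|) * ‖T‖)) ≤
        N * (κ * (K₁ * t ^ 2) * (C * (2 * a * |t|) * ‖T‖)) := by gcongr
    have e5 : N * (κ * (K₁ * t ^ 2) * (C * (2 * a * |t|) * ‖T‖)) = K₂ * ‖T‖ * |t| ^ 3 := by
      rw [hK₂, ← sq_abs t]; ring
    have e6 : K₂ * ‖T‖ * |t| ^ 3 ≤ (K₁ + K₂) * ‖T‖ * |t| ^ 3 := by gcongr; linarith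
    linarith

end NearestPoints

namespace RNNAL

/-! ### Projection onto the dual cone. -/

section DualConeProjection

variable {p : Type*} [Fintype p] (K : Set (Matrix p p ℝ))

theorem proj_mem_metricProj (X : Matrix p p ℝ) :
    proj (dualCone K) X ∈ metricProj (dualCone K) X :=
  Classical.epsilon_spec (existsUnique_mem_metricProj_dualCone K X).exists

theorem proj_mem_dualCone (X : Matrix p p ℝ) : proj (dualCone K) X ∈ dualCone K :=
  (proj_mem_metricProj K X).1

variable {K}

theorem add_mem_dualCone {Y Z : Matrix p p ℝ} (hY : Y ∈ dualCone K) (hZ : Z ∈ dualCone K) :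
    Y + Z ∈ dualCone K :=
  ⟨hY.1.add hZ.1, fun X hX => by
    rw [inner_add_right]; exact add_nonneg (hY.2 X hX) (hZ.2 X hX)⟩

theorem smul_mem_dualCone {Y : Matrix p p ℝ} (hY : Y ∈ dualCone K) {s : ℝ} (hs : 0 ≤ s) :
    s • Y ∈ dualCone K :=
  ⟨hY.1.smul s, fun X hX => by
    rw [inner_smul_right]; exact mul_nonneg hs (hY.2 X hX)⟩

variable (K)

/-- First-order optimality of the projection along an admissible direction. Taking `W` in the cone
and then `W = -Π X` yields the two halves of Moreau's characterization below. -/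
theorem inner_proj_sub_nonneg_of_segment (X W : Matrix p p ℝ)
    (hW : ∀ s : ℝ, 0 < s → s ≤ 1 → proj (dualCone K) X + s • W ∈ dualCone K) :
    0 ≤ inner ℝ (proj (dualCone K) X - X) W := by
  set v := proj (dualCone K) X with hv
  have hmin : ∀ s : ℝ, 0 < s → s ≤ 1 → 0 ≤ 2 * inner ℝ (v - X) W + s * ‖W‖ ^ 2 := by
    intro s hs hs1
    have h1 := (proj_mem_metricProj K X).2 _ (hW s hs hs1)
    rw [← hv] at h1
    have h2 : ‖v - X‖ ^ 2 ≤ ‖v + s • W - X‖ ^ 2 := by gcongr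
    rw [show v + s • W - X = (v - X) + s • W by abel, norm_add_sq_real, inner_smul_right,
      norm_smul, mul_pow, Real.norm_eq_abs, sq_abs] at h2
    refine le_of_mul_le_mul_left ?_ hs
    nlinarith
  by_contra! h
  have hW2 : 0 ≤ ‖W‖ ^ 2 := by positivity
  set a := -inner ℝ (v - X) W with ha
  have ha0 : 0 < a := by linarith
  -- This step length makes `s‖W‖² ≤ a`, too little to compensate `-2a`.
  have h3 := hmin (a / (a + ‖W‖ ^ 2)) (by positivity) (by
    rw [div_le_one (by positivity)]; linarith)
  have h4 : a / (a + ‖W‖ ^ 2) * ‖W‖ ^ 2 ≤ a := by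
    rw [div_mul_eq_mul_div, div_le_iff₀ (by positivity)]; nlinarith
  linarith

theorem inner_sub_proj_nonpos (X : Matrix p p ℝ) {Z : Matrix p p ℝ} (hZ : Z ∈ dualCone K) :
    inner ℝ (X - proj (dualCone K) X) Z ≤ 0 := by
  have := inner_proj_sub_nonneg_of_segment K X Z fun s hs _ =>
    add_mem_dualCone (proj_mem_dualCone K X) (smul_mem_dualCone hZ hs.le)
  rw [← neg_sub, inner_neg_left]; linarith

theorem inner_sub_proj_self (X : Matrix p p ℝ) :
    inner ℝ (X - proj (dualCone K) X) (proj (dualCone K) X) = 0 := by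
  refine le_antisymm (inner_sub_proj_nonpos K X (proj_mem_dualCone K X)) ?_
  have := inner_proj_sub_nonneg_of_segment K X (-proj (dualCone K) X) fun s _ hs => by
    have : proj (dualCone K) X + s • -proj (dualCone K) X = (1 - s) • proj (dualCone K) X := by
      module
    rw [this]
    exact smul_mem_dualCone (proj_mem_dualCone K X) (by linarith)
  rw [inner_neg_right, ← inner_neg_left, neg_sub] at this
  exact this

theorem norm_proj_sub_proj_le (X Y : Matrix p p ℝ) :
    ‖proj (dualCone K) Y - proj (dualCone K) X‖ ≤ ‖Y - X‖ := by
  set u := proj (dualCone K) X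
  set v := proj (dualCone K) Y
  have h1 : inner ℝ (X - u) v ≤ 0 := inner_sub_proj_nonpos K X (proj_mem_dualCone K Y)
  have h2 : inner ℝ (Y - v) u ≤ 0 := inner_sub_proj_nonpos K Y (proj_mem_dualCone K X)
  have h3 : inner ℝ (X - u) u = 0 := inner_sub_proj_self K X
  have h4 : inner ℝ (Y - v) v = 0 := inner_sub_proj_self K Y
  have h5 : ‖v - u‖ ^ 2 ≤ inner ℝ (Y - X) (v - u) := by
    have : inner ℝ (Y - X) (v - u) - ‖v - u‖ ^ 2 =
        inner ℝ (Y - v) v - inner ℝ (Y - v) u - inner ℝ (X - u) v + inner ℝ (X - u) u := by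
      rw [← real_inner_self_eq_norm_sq]
      simp only [inner_sub_left, inner_sub_right]
      ring
    linarith
  have h6 := h5.trans (real_inner_le_norm _ _)
  rcases (norm_nonneg (v - u)).eq_or_lt with h | h
  · rw [← h]; positivity
  · exact le_of_mul_le_mul_right (by linarith [sq ‖v - u‖]) h

/-- The subgradient inequality: `½‖Π X‖²` is convex with gradient `Π X`. -/
theorem half_norm_sq_proj_ge (X Y : Matrix p p ℝ) :
    ‖proj (dualCone K) X‖ ^ 2 / 2 + inner ℝ (proj (dualCone K) X) (Y - X) ≤
      ‖proj (dualCone K) Y‖ ^ 2 / 2 := by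
  set u := proj (dualCone K) X
  set v := proj (dualCone K) Y
  have h2 : inner ℝ (Y - v) u ≤ 0 := inner_sub_proj_nonpos K Y (proj_mem_dualCone K X)
  have h3 : inner ℝ (X - u) u = 0 := inner_sub_proj_self K X
  have h4 : 0 ≤ ‖v - u‖ ^ 2 := by positivity
  rw [norm_sub_sq_real] at h4
  rw [inner_sub_left] at h2 h3
  rw [real_inner_self_eq_norm_sq] at h3
  rw [inner_sub_right, real_inner_comm Y, real_inner_comm X]
  linarith

/-- The subgradient inequality used at both points sandwiches the remainder between `0` and `⟪Π Y -
Π X, Y - X⟫`, and `Π` is nonexpansive. -/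
theorem abs_half_norm_sq_proj_sub_le (X Y : Matrix p p ℝ) :
    |‖proj (dualCone K) Y‖ ^ 2 / 2 - ‖proj (dualCone K) X‖ ^ 2 / 2
      - inner ℝ (proj (dualCone K) X) (Y - X)| ≤ ‖Y - X‖ ^ 2 := by
  have h1 := half_norm_sq_proj_ge K X Y
  have h2 := half_norm_sq_proj_ge K Y X
  have h3 : inner ℝ (proj (dualCone K) Y - proj (dualCone K) X) (Y - X) ≤ ‖Y - X‖ ^ 2 := by
    refine (real_inner_le_norm _ _).trans ?_
    rw [sq]; gcongr; exact norm_proj_sub_proj_le K X Y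
  rw [inner_sub_left] at h3
  rw [← neg_sub Y X, inner_neg_right] at h2
  rw [abs_of_nonneg (by linarith)]
  linarith

end DualConeProjection

/-! ### First-order model of the objective. -/

section Objective

variable {n r : ℕ} (Q : Matrix (Fin n) (Fin n) ℝ) (c : Fin n → ℝ)
  (K : Set (Matrix (Unit ⊕ Fin n) (Unit ⊕ Fin n) ℝ)) {σ : ℝ}
  (Wt : Matrix (Unit ⊕ Fin n) (Unit ⊕ Fin n) ℝ)

theorem abs_phi_sub_le (hσ : 0 < σ) (Y Y' : Matrix (Unit ⊕ Fin n) (Unit ⊕ Fin n) ℝ) :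
    |phi Q c K σ Wt Y' - phi Q c K σ Wt Y
      - inner ℝ (costC Q c - σ • proj (dualCone K) (σ⁻¹ • Wt - Y)) (Y' - Y)|
      ≤ σ * ‖Y' - Y‖ ^ 2 := by
  have h := abs_half_norm_sq_proj_sub_le K (σ⁻¹ • Wt - Y) (σ⁻¹ • Wt - Y')
  rw [show σ⁻¹ • Wt - Y' - (σ⁻¹ • Wt - Y) = -(Y' - Y) by abel, norm_neg, inner_neg_right] at h
  have e : phi Q c K σ Wt Y' - phi Q c K σ Wt Y
      - inner ℝ (costC Q c - σ • proj (dualCone K) (σ⁻¹ • Wt - Y)) (Y' - Y) =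
      σ * (‖proj (dualCone K) (σ⁻¹ • Wt - Y')‖ ^ 2 / 2 -
        ‖proj (dualCone K) (σ⁻¹ • Wt - Y)‖ ^ 2 / 2 -
        -inner ℝ (proj (dualCone K) (σ⁻¹ • Wt - Y)) (Y' - Y)) := by
    simp only [phi, inner_sub_left, inner_sub_right, inner_smul_left, RCLike.conj_to_real]
    ring
  rw [e, abs_mul, abs_of_pos hσ]
  gcongr

/-- `C - W`, the gradient of `φ` at `R̂ R̂ᵀ`. -/
noncomputable def gradPhi (σ : ℝ) (R : Matrix (Fin n) (Fin r) ℝ) :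
    Matrix (Unit ⊕ Fin n) (Unit ⊕ Fin n) ℝ :=
  costC Q c - dualW K σ Wt R

/-- The gradient `2 ((C - W) R̂)₂` of the objective. -/
noncomputable def gradObjective (σ : ℝ) (R : Matrix (Fin n) (Fin r) ℝ) :
    Matrix (Fin n) (Fin r) ℝ :=
  (2 : ℝ) • (gradPhi Q c K Wt σ R * hat R).toRows₂

theorem dualW_isSymm (σ : ℝ) (R : Matrix (Fin n) (Fin r) ℝ) : (dualW K σ Wt R).IsSymm :=
  (proj_mem_dualCone K _).1.smul σ

variable {Q} in
theorem gradPhi_isSymm (hQ : Q.IsSymm) (σ : ℝ) (R : Matrix (Fin n) (Fin r) ℝ) :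
    (gradPhi Q c K Wt σ R).IsSymm := by
  refine Matrix.IsSymm.sub ?_ (dualW_isSymm K Wt σ R)
  refine Matrix.IsSymm.fromBlocks ?_ ?_ hQ
  · simp [Matrix.IsSymm]
  · ext; rfl

/-- The variation `(0 ; E)` of `R̂` caused by a variation `E` of `R`. -/
def hatVar (E : Matrix (Fin n) (Fin r) ℝ) : Matrix (Unit ⊕ Fin n) (Fin r) ℝ := fromRows 0 E

theorem hat_add (R E : Matrix (Fin n) (Fin r) ℝ) : hat (R + E) = hat R + hatVar E := by
  ext (i | i) j <;> simp [hat, hatVar]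

theorem hatVar_add (E F : Matrix (Fin n) (Fin r) ℝ) : hatVar (E + F) = hatVar E + hatVar F := by
  ext (i | i) j <;> simp [hatVar]

theorem hatVar_smul (t : ℝ) (E : Matrix (Fin n) (Fin r) ℝ) : hatVar (t • E) = t • hatVar E := by
  ext (i | i) j <;> simp [hatVar]

theorem inner_hatVar (M : Matrix (Unit ⊕ Fin n) (Fin r) ℝ) (E : Matrix (Fin n) (Fin r) ℝ) :
    inner ℝ M (hatVar E) = inner ℝ M.toRows₂ E := by
  simp [inner_def, trace, mul_apply, hatVar, toRows₂]

theorem norm_hatVar (E : Matrix (Fin n) (Fin r) ℝ) : ‖hatVar E‖ = ‖E‖ := by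
  have h : ‖hatVar E‖ ^ 2 = ‖E‖ ^ 2 := by
    rw [← real_inner_self_eq_norm_sq, inner_hatVar, ← real_inner_self_eq_norm_sq]; rfl
  exact (pow_left_inj₀ (norm_nonneg _) (norm_nonneg _) two_ne_zero).1 h

theorem toRows₂_mul_hatVar (N : Matrix (Unit ⊕ Fin n) (Unit ⊕ Fin n) ℝ)
    (E : Matrix (Fin n) (Fin r) ℝ) : (N * hatVar E).toRows₂ = N.toBlocks₂₂ * E := by
  ext i j
  simp [mul_apply, hatVar, toRows₂, toBlocks₂₂]

theorem toRows₂_mul_hat (N : Matrix (Unit ⊕ Fin n) (Unit ⊕ Fin n) ℝ)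
    (R : Matrix (Fin n) (Fin r) ℝ) : (N * hat R).toRows₂ =
      vecMulVec (fun i => N.toBlocks₂₁ i ()) (e₁ r) + N.toBlocks₂₂ * R := by
  ext i j
  simp [mul_apply, hat, toRows₂, toBlocks₂₂, toBlocks₂₁, vecMulVec_apply]

/-- The change of `R̂ R̂ᵀ` caused by a variation `E` of `R`. -/
theorem hat_add_mul_sub (R E : Matrix (Fin n) (Fin r) ℝ) :
    hat (R + E) * (hat (R + E))ᵀ - hat R * (hat R)ᵀ =
      hat R * (hatVar E)ᵀ + (hat R * (hatVar E)ᵀ)ᵀ + hatVar E * (hatVar E)ᵀ := by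
  rw [hat_add, transpose_add, transpose_mul, transpose_transpose]
  simp only [Matrix.add_mul, Matrix.mul_add]
  abel

/-- An exact identity: `R̂R̂ᵀ` is quadratic in `R`, and the symmetry of `N` makes the two cross
terms equal. -/
theorem inner_symm_hat_add_mul_sub {N : Matrix (Unit ⊕ Fin n) (Unit ⊕ Fin n) ℝ} (hN : N.IsSymm)
    (R E : Matrix (Fin n) (Fin r) ℝ) :
    inner ℝ N (hat (R + E) * (hat (R + E))ᵀ - hat R * (hat R)ᵀ) =
      inner ℝ ((2 : ℝ) • (N * hat R).toRows₂) E + inner ℝ (N.toBlocks₂₂ * E) E := by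
  have h1 : ∀ X Y : Matrix (Unit ⊕ Fin n) (Fin r) ℝ,
      inner ℝ N (Y * Xᵀ) = inner ℝ (N * X) Y := fun X Y => by
    simp only [inner_def, transpose_mul, transpose_transpose, Matrix.mul_assoc]
  have h2 : ∀ Y : Matrix (Unit ⊕ Fin n) (Unit ⊕ Fin n) ℝ,
      inner ℝ N Yᵀ = inner ℝ N Y := fun Y => by
    rw [inner_def, inner_def, ← trace_transpose, transpose_mul, transpose_transpose,
      show Nᵀ = N from hN, trace_mul_comm]
  rw [hat_add_mul_sub, inner_add_right, inner_add_right, h2, ← h2 (hat R * _), transpose_mul,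
    transpose_transpose, h1, h1, inner_hatVar, inner_hatVar, toRows₂_mul_hatVar, inner_smul_left]
  simp only [RCLike.conj_to_real]
  ring

theorem norm_hat_add_mul_sub_le (R E : Matrix (Fin n) (Fin r) ℝ) :
    ‖hat (R + E) * (hat (R + E))ᵀ - hat R * (hat R)ᵀ‖ ≤
      2 * ‖hat R * (hatVar E)ᵀ‖ + ‖E‖ ^ 2 := by
  rw [hat_add_mul_sub]
  have h1 := norm_add_le (hat R * (hatVar E)ᵀ + (hat R * (hatVar E)ᵀ)ᵀ) (hatVar E * (hatVar E)ᵀ)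
  have h2 := norm_add_le (hat R * (hatVar E)ᵀ) (hat R * (hatVar E)ᵀ)ᵀ
  have h3 := frobenius_norm_mul (hatVar E) (hatVar E)ᵀ
  rw [frobenius_norm_transpose] at h2 h3
  rw [norm_hatVar] at h3
  nlinarith

variable {Q} in
-- The error is kept in terms of the cross product `R̂(0; E)ᵀ` instead of `‖E‖`: for rank-raising
-- steps that product is `O(t²)`, so the bound is of order `t⁴` and not `t²`.
theorem abs_objective_add_sub_le (hσ : 0 < σ) (hQ : Q.IsSymm) (R E : Matrix (Fin n) (Fin r) ℝ) :
    |objective Q c K σ Wt (R + E) - objective Q c K σ Wt R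
        - inner ℝ (gradObjective Q c K Wt σ R) E
        - inner ℝ ((gradPhi Q c K Wt σ R).toBlocks₂₂ * E) E|
      ≤ σ * (2 * ‖hat R * (hatVar E)ᵀ‖ + ‖E‖ ^ 2) ^ 2 := by
  have h := abs_phi_sub_le Q c K Wt hσ (hat R * (hat R)ᵀ) (hat (R + E) * (hat (R + E))ᵀ)
  have h2 := inner_symm_hat_add_mul_sub (gradPhi_isSymm c K Wt hQ σ R) R E
  rw [gradPhi, dualW] at h2
  rw [h2, ← sub_sub] at h
  refine le_trans h ?_
  gcongr
  exact norm_hat_add_mul_sub_le R E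

variable {Q} in
theorem hasGradientAt_objective (hσ : 0 < σ) (hQ : Q.IsSymm) (R : Matrix (Fin n) (Fin r) ℝ) :
    HasGradientAt (fun X : Matrix (Fin n) (Fin r) ℝ => objective Q c K σ Wt X)
      (gradObjective Q c K Wt σ R) R := by
  rw [hasGradientAt_iff_isLittleO_nhds_zero]
  set N := gradPhi Q c K Wt σ R with hN
  set a := ‖N.toBlocks₂₂‖
  set d := ‖hat R‖
  have hbound : ∀ E : Matrix (Fin n) (Fin r) ℝ, ‖objective Q c K σ Wt (R + E)
      - objective Q c K σ Wt R - inner ℝ (gradObjective Q c K Wt σ R) E‖ ≤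
      ‖(a * ‖E‖ + σ * (2 * d + ‖E‖) ^ 2 * ‖E‖) * ‖E‖‖ := fun E => by
    have h1 := abs_objective_add_sub_le c K Wt hσ hQ R E
    have h2 : |inner ℝ (N.toBlocks₂₂ * E) E| ≤ a * ‖E‖ * ‖E‖ :=
      (abs_real_inner_le_norm _ _).trans (by gcongr; exact frobenius_norm_mul _ _)
    have h3 : ‖hat R * (hatVar E)ᵀ‖ ≤ d * ‖E‖ := by
      refine (frobenius_norm_mul _ _).trans ?_
      rw [frobenius_norm_transpose, norm_hatVar]
    have h4 : σ * (2 * ‖hat R * (hatVar E)ᵀ‖ + ‖E‖ ^ 2) ^ 2 ≤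
        σ * (2 * (d * ‖E‖) + ‖E‖ ^ 2) ^ 2 := by gcongr
    have h5 : σ * (2 * (d * ‖E‖) + ‖E‖ ^ 2) ^ 2 = σ * (2 * d + ‖E‖) ^ 2 * ‖E‖ * ‖E‖ := by ring
    have h6 := abs_add_le (objective Q c K σ Wt (R + E) - objective Q c K σ Wt R
        - inner ℝ (gradObjective Q c K Wt σ R) E - inner ℝ (N.toBlocks₂₂ * E) E)
        (inner ℝ (N.toBlocks₂₂ * E) E)
    rw [sub_add_cancel] at h6
    rw [Real.norm_eq_abs]
    refine le_trans ?_ (le_abs_self _)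
    rw [add_mul]
    linarith
  refine (IsBigO.of_bound' (Eventually.of_forall hbound)).trans_isLittleO ?_
  have ht : Tendsto (fun E : Matrix (Fin n) (Fin r) ℝ =>
      a * ‖E‖ + σ * (2 * d + ‖E‖) ^ 2 * ‖E‖) (𝓝 0) (𝓝 0) := by
    have : Continuous fun E : Matrix (Fin n) (Fin r) ℝ =>
      a * ‖E‖ + σ * (2 * d + ‖E‖) ^ 2 * ‖E‖ := by fun_prop
    simpa using this.tendsto 0
  have h := ((isLittleO_one_iff ℝ).2 ht).mul_isBigO
    (isBigO_refl (fun E : Matrix (Fin n) (Fin r) ℝ => ‖E‖) (𝓝 0))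
  simp only [one_mul] at h
  exact h.of_norm_right

end Objective

end RNNAL

namespace RNNAL

/-! ### Constraints, their gradients and the normal equation. -/

section Constraints

variable {m n r : ℕ} (A : Matrix (Fin m) (Fin n) ℝ) (b : Fin m → ℝ) (B : Finset (Fin n))

/-- The coordinates of an element of the constraint space. -/
def coord : (Fin m × Fin r) ⊕ B → Matrix (Fin m) (Fin r) ℝ × (B → ℝ) → ℝ
  | Sum.inl (k, j), p => p.1 k j
  | Sum.inr i, p => p.2 i

/-- The coordinate vectors of the constraint space. -/
def coordVec : (Fin m × Fin r) ⊕ B → Matrix (Fin m) (Fin r) ℝ × (B → ℝ)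
  | Sum.inl (k, j) => (Matrix.single k j 1, 0)
  | Sum.inr i => (0, Pi.single i 1)

theorem coord_ext {p q : Matrix (Fin m) (Fin r) ℝ × (B → ℝ)}
    (h : ∀ k, coord B k p = coord B k q) : p = q :=
  Prod.ext (Matrix.ext fun k j => h (Sum.inl (k, j))) (funext fun i => h (Sum.inr i))

theorem inner_diagBAdj_mul (μ : B → ℝ) (X Y : Matrix (Fin n) (Fin r) ℝ) :
    inner ℝ (diagBAdj B μ * X) Y = ∑ i : B, μ i * diagB B (Y * Xᵀ) i := by
  rw [real_inner_comm, inner_def, transpose_mul, ← Matrix.mul_assoc, trace_mul_comm, diagBAdj,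
    diagonal_transpose]
  simp only [trace, diag, diagonal_mul, sum_extendB, diagB]

/-- Adjointness of `hAdj` and `hMap`; the pairing on the constraint space is a sum over coordinates
because the product type carries a sup norm. -/
theorem inner_hAdj (R : Matrix (Fin n) (Fin r) ℝ) (p : Matrix (Fin m) (Fin r) ℝ × (B → ℝ))
    (H : Matrix (Fin n) (Fin r) ℝ) :
    inner ℝ (hAdj A B R p) H = ∑ k, coord B k p * coord B k (hMap A B R H) := by
  have e1 : inner ℝ (Aᵀ * p.1) H = ∑ k, ∑ j, p.1 k j * (A * H) k j := by
    have : inner ℝ (Aᵀ * p.1) H = inner ℝ p.1 (A * H) := by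
      rw [inner_def, inner_def, transpose_mul, Matrix.mul_assoc, trace_mul_comm, Matrix.mul_assoc]
    rw [this, inner_def, trace]
    exact Finset.sum_congr rfl fun k _ => by rw [diag, mul_apply]; rfl
  rw [hAdj, inner_add_left, e1, inner_diagBAdj_mul, Fintype.sum_sum_type,
    Fintype.sum_prod_type]
  congr 1
  refine Finset.sum_congr rfl fun i _ => ?_
  simp only [coord, hMap, diagB, mul_apply, mulVec, dotProduct, transpose_apply, Matrix.sub_apply,
    Matrix.smul_apply, vecMulVec_apply, smul_eq_mul, Finset.mul_sum, ← Finset.sum_sub_distrib]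
  exact Finset.sum_congr rfl fun j _ => by ring

theorem coord_coordVec (k l : (Fin m × Fin r) ⊕ B) :
    coord B l (coordVec B k) = if k = l then 1 else 0 := by
  rcases k with ⟨k, j⟩ | i <;> rcases l with ⟨k', j'⟩ | i' <;>
    simp [coord, coordVec, Matrix.single_apply, Pi.single_apply, eq_comm]

/-- The gradients of the constraint functions. -/
noncomputable def gradConstraint (k : (Fin m × Fin r) ⊕ B) (R : Matrix (Fin n) (Fin r) ℝ) :
    Matrix (Fin n) (Fin r) ℝ := hAdj A B R (coordVec B k)

theorem inner_gradConstraint (k : (Fin m × Fin r) ⊕ B) (R H : Matrix (Fin n) (Fin r) ℝ) :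
    inner ℝ (gradConstraint A B k R) H = coord B k (hMap A B R H) := by
  rw [gradConstraint, inner_hAdj]
  simp [coord_coordVec]

theorem hAdj_eq_sum (R : Matrix (Fin n) (Fin r) ℝ) (p : Matrix (Fin m) (Fin r) ℝ × (B → ℝ)) :
    hAdj A B R p = ∑ k, coord B k p • gradConstraint A B k R := by
  refine ext_inner_right ℝ fun H => ?_
  simp only [inner_hAdj, sum_inner, inner_smul_left, inner_gradConstraint, RCLike.conj_to_real]

theorem constraint_add (k : (Fin m × Fin r) ⊕ B) (R E : Matrix (Fin n) (Fin r) ℝ) :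
    constraint A b B r k (R + E) = constraint A b B r k R
      + inner ℝ (gradConstraint A B k R) E + coord B k (0, diagB B (E * Eᵀ)) := by
  rw [inner_gradConstraint]
  rcases k with ⟨k, j⟩ | i
  · simp only [constraint, coord, hMap, Matrix.mul_add, Matrix.add_apply, Matrix.zero_apply]
    ring
  · have h : (R * Eᵀ) i i = (E * Rᵀ) i i := by simp [mul_apply, mul_comm]
    simp only [constraint, coord, hMap, diagB, transpose_add, Matrix.mul_add, Matrix.add_mul,
      Matrix.add_apply, add_mulVec, Pi.add_apply, h]
    ring

theorem abs_coord_zero_diagB_le (k : (Fin m × Fin r) ⊕ B) (E : Matrix (Fin n) (Fin r) ℝ) :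
    |coord B k (0, diagB B (E * Eᵀ))| ≤ ‖E‖ ^ 2 := by
  rcases k with ⟨k, j⟩ | i
  · simp [coord]
  · have h : ∀ i, 0 ≤ (E * Eᵀ) i i := fun i => by
      simpa [mul_apply] using Finset.sum_nonneg fun j _ => mul_self_nonneg (E i j)
    simp only [coord, diagB]
    rw [abs_of_nonneg (h i), ← real_inner_self_eq_norm_sq, inner_def, trace]
    exact Finset.single_le_sum (f := fun i => (E * Eᵀ) i i) (fun i _ => h i) (Finset.mem_univ _)

/-- The gradients are affine in `R`. The requirement `1 ≤ C` lets the same constant serve for the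
second-order remainders of the constraints, which are at most `‖E‖²`. -/
theorem exists_gradConstraint_bounds (m r : ℕ) (A : Matrix (Fin m) (Fin n) ℝ) :
    ∃ C : ℝ, 1 ≤ C ∧ ∀ (k : (Fin m × Fin r) ⊕ B) (X Y : Matrix (Fin n) (Fin r) ℝ),
      ‖gradConstraint A B k Y - gradConstraint A B k X‖ ≤ C * ‖Y - X‖ := by
  refine ⟨1 + ∑ k : (Fin m × Fin r) ⊕ B, ‖diagBAdj B (coordVec B k).2‖ * 2,
    le_add_of_nonneg_right (by positivity), fun k X Y => ?_⟩
  have h : gradConstraint A B k Y - gradConstraint A B k X =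
      diagBAdj B (coordVec B k).2 * ((2 : ℝ) • (Y - X)) := by
    simp only [gradConstraint, hAdj]
    rw [add_sub_add_left_eq_sub, ← Matrix.mul_sub, sub_sub_sub_cancel_right, smul_sub]
  have h2 : ‖diagBAdj B (coordVec B k).2‖ * 2 ≤
      ∑ k : (Fin m × Fin r) ⊕ B, ‖diagBAdj B (coordVec B k).2‖ * 2 :=
    Finset.single_le_sum (f := fun k : (Fin m × Fin r) ⊕ B => ‖diagBAdj B (coordVec B k).2‖ * 2)
      (fun _ _ => by positivity) (Finset.mem_univ k)
  rw [h]
  refine (frobenius_norm_mul _ _).trans ?_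
  rw [norm_smul, Real.norm_two, ← mul_assoc]
  gcongr
  linarith

theorem gradient_constraint (k : (Fin m × Fin r) ⊕ B) (R : Matrix (Fin n) (Fin r) ℝ) :
    gradient (constraint A b B r k) R = gradConstraint A B k R := by
  refine HasGradientAt.gradient ?_
  rw [hasGradientAt_iff_isLittleO_nhds_zero]
  have hb : ∀ E : Matrix (Fin n) (Fin r) ℝ, ‖constraint A b B r k (R + E)
      - constraint A b B r k R - inner ℝ (gradConstraint A B k R) E‖ ≤ ‖‖E‖ ^ 2‖ := fun E => by
    rw [constraint_add, add_sub_assoc, add_sub_assoc, Real.norm_of_nonneg (sq_nonneg ‖E‖)]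
    simpa [add_sub_assoc, add_sub_cancel_left] using abs_coord_zero_diagB_le (m := m) B k E
  refine (IsBigO.of_bound' (Eventually.of_forall hb)).trans_isLittleO ?_
  exact (isLittleO_norm_pow_id one_lt_two)

theorem mem_variety_iff (R : Matrix (Fin n) (Fin r) ℝ) :
    R ∈ variety A b B r ↔ ∀ k, constraint A b B r k R = 0 := by
  constructor
  · rintro ⟨h1, h2⟩ (⟨k, j⟩ | i)
    · simp [constraint, h1, vecMulVec_apply]
    · simpa [constraint, sub_eq_zero, diagB] using congrFun h2 i
  · intro h
    refine ⟨Matrix.ext fun k j => ?_, funext fun i => ?_⟩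
    · simpa [constraint, sub_eq_zero, vecMulVec_apply] using h (Sum.inl (k, j))
    · simpa [constraint, sub_eq_zero, diagB] using h (Sum.inr i)

variable {A b B}

theorem LICQ.linearIndependent_gradConstraint {R : Matrix (Fin n) (Fin r) ℝ}
    (h : LICQ A b B R) : LinearIndependent ℝ fun k => gradConstraint A B k R := by
  simpa only [LICQ, gradient_constraint] using h

theorem LICQ.hAdj_injective {R : Matrix (Fin n) (Fin r) ℝ} (h : LICQ A b B R)
    {p : Matrix (Fin m) (Fin r) ℝ × (B → ℝ)} (hp : hAdj A B R p = 0) : p = 0 := by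
  rw [hAdj_eq_sum] at hp
  have := Fintype.linearIndependent_iff.1 h.linearIndependent_gradConstraint _ hp
  refine coord_ext B fun k => (this k).trans ?_
  rcases k with k | k <;> rfl

variable (A B) in
/-- The differential `hMap` of the constraints as a linear map. -/
noncomputable def hLin (R : Matrix (Fin n) (Fin r) ℝ) :
    Matrix (Fin n) (Fin r) ℝ →ₗ[ℝ] Matrix (Fin m) (Fin r) ℝ × (B → ℝ) where
  toFun := hMap A B R
  map_add' X Y := by
    refine coord_ext B ?_
    rintro (⟨k, j⟩ | i)
    · simp [coord, hMap, Matrix.mul_add]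
    · simp [coord, hMap, diagB, Matrix.add_mul, add_mulVec]; ring
  map_smul' t X := by
    refine coord_ext B ?_
    rintro (⟨k, j⟩ | i)
    · simp [coord, hMap]
    · simp [coord, hMap, diagB, smul_mulVec]; ring

variable (A B) in
/-- The adjoint `hAdj` as a linear map. -/
noncomputable def hAdjLin (R : Matrix (Fin n) (Fin r) ℝ) :
    Matrix (Fin m) (Fin r) ℝ × (B → ℝ) →ₗ[ℝ] Matrix (Fin n) (Fin r) ℝ where
  toFun := hAdj A B R
  map_add' p q := by
    refine ext_inner_right ℝ fun H => ?_
    rw [inner_add_left, inner_hAdj, inner_hAdj, inner_hAdj, ← Finset.sum_add_distrib]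
    refine Finset.sum_congr rfl fun k _ => ?_
    rw [← add_mul]
    rcases k with k | k <;> rfl
  map_smul' t p := by
    refine ext_inner_right ℝ fun H => ?_
    rw [inner_smul_left, inner_hAdj, inner_hAdj, Finset.mul_sum]
    refine Finset.sum_congr rfl fun k _ => ?_
    rw [← mul_assoc]
    rcases k with k | k <;> rfl

/-- If `h h* p = 0`, then `‖h* p‖² = ⟪p, h h* p⟫ = 0`, and LICQ makes `h*` injective. Surjectivity
then follows by dimension. -/
theorem LICQ.normal_injective {R : Matrix (Fin n) (Fin r) ℝ} (h : LICQ A b B R) :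
    Function.Injective fun p => hMap A B R (hAdj A B R p) := by
  have : Function.Injective (hLin A B R ∘ₗ hAdjLin A B R) := by
    rw [← LinearMap.ker_eq_bot, LinearMap.ker_eq_bot']
    intro p hp
    refine h.hAdj_injective ?_
    have h0 : hMap A B R (hAdj A B R p) = 0 := hp
    rw [← inner_self_eq_zero (𝕜 := ℝ), inner_hAdj, h0]
    refine Finset.sum_eq_zero fun k _ => ?_
    rcases k with k | k <;> exact mul_zero _
  exact this

theorem LICQ.normal_surjective {R : Matrix (Fin n) (Fin r) ℝ} (h : LICQ A b B R) :
    Function.Surjective fun p => hMap A B R (hAdj A B R p) :=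
  LinearMap.surjective_of_injective (f := hLin A B R ∘ₗ hAdjLin A B R) h.normal_injective

end Constraints

/-! ### Appending columns. -/

section AppendCols

variable {m n r τ : ℕ}

theorem e₁_castAdd (i : Fin r) : e₁ (r + τ) (Fin.castAdd τ i) = e₁ r i := rfl

/-- For `r = 0` the first coordinate would lie in the appended block, so `1 ≤ r` is essential here
and in what follows. -/
theorem e₁_natAdd (hr : 1 ≤ r) (i : Fin τ) : e₁ (r + τ) (Fin.natAdd r i) = 0 := by
  simp [e₁]; omega

@[simp] theorem appendCols_castAdd (R : Matrix (Fin n) (Fin r) ℝ) (H : Matrix (Fin n) (Fin τ) ℝ)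
    (i : Fin n) (j : Fin r) : appendCols R H i (Fin.castAdd τ j) = R i j := by
  simp [appendCols]

@[simp] theorem appendCols_natAdd (R : Matrix (Fin n) (Fin r) ℝ) (H : Matrix (Fin n) (Fin τ) ℝ)
    (i : Fin n) (j : Fin τ) : appendCols R H i (Fin.natAdd r j) = H i j := by
  simp [appendCols]

theorem cols_ext {p : Type*} {X Y : Matrix p (Fin (r + τ)) ℝ}
    (h1 : ∀ i j, X i (Fin.castAdd τ j) = Y i (Fin.castAdd τ j))
    (h2 : ∀ i j, X i (Fin.natAdd r j) = Y i (Fin.natAdd r j)) : X = Y :=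
  Matrix.ext fun i j => Fin.addCases (h1 i) (h2 i) j

theorem mul_appendCols (M : Matrix (Fin m) (Fin n) ℝ) (R : Matrix (Fin n) (Fin r) ℝ)
    (H : Matrix (Fin n) (Fin τ) ℝ) : M * appendCols R H = appendCols (M * R) (M * H) :=
  cols_ext (by simp [mul_apply]) (by simp [mul_apply])

theorem appendCols_mul_transpose (R R' : Matrix (Fin n) (Fin r) ℝ)
    (H H' : Matrix (Fin n) (Fin τ) ℝ) :
    appendCols R H * (appendCols R' H')ᵀ = R * R'ᵀ + H * H'ᵀ := by
  ext i j
  simp [mul_apply, Fin.sum_univ_add]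

theorem appendCols_mulVec (hr : 1 ≤ r) (R : Matrix (Fin n) (Fin r) ℝ)
    (H : Matrix (Fin n) (Fin τ) ℝ) : appendCols R H *ᵥ e₁ (r + τ) = R *ᵥ e₁ r := by
  ext i
  simp [mulVec, dotProduct, Fin.sum_univ_add, e₁_castAdd, e₁_natAdd hr]

theorem vecMulVec_e₁_add (hr : 1 ≤ r) (v : Fin n → ℝ) :
    vecMulVec v (e₁ (r + τ)) = appendCols (vecMulVec v (e₁ r)) (0 : Matrix _ (Fin τ) ℝ) :=
  cols_ext (by simp [vecMulVec_apply, e₁_castAdd]) (by simp [vecMulVec_apply, e₁_natAdd hr])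

theorem appendCols_add (R R' : Matrix (Fin n) (Fin r) ℝ) (H H' : Matrix (Fin n) (Fin τ) ℝ) :
    appendCols R H + appendCols R' H' = appendCols (R + R') (H + H') :=
  cols_ext (by simp) (by simp)

theorem appendCols_sub (R R' : Matrix (Fin n) (Fin r) ℝ) (H H' : Matrix (Fin n) (Fin τ) ℝ) :
    appendCols R H - appendCols R' H' = appendCols (R - R') (H - H') :=
  cols_ext (by simp) (by simp)

theorem smul_appendCols (t : ℝ) (R : Matrix (Fin n) (Fin r) ℝ) (H : Matrix (Fin n) (Fin τ) ℝ) :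
    t • appendCols R H = appendCols (t • R) (t • H) :=
  cols_ext (by simp) (by simp)

@[simp] theorem appendCols_zero : appendCols (0 : Matrix (Fin n) (Fin r) ℝ)
    (0 : Matrix (Fin n) (Fin τ) ℝ) = 0 :=
  cols_ext (by simp) (by simp)

theorem inner_appendCols (R R' : Matrix (Fin n) (Fin r) ℝ) (H H' : Matrix (Fin n) (Fin τ) ℝ) :
    inner ℝ (appendCols R H) (appendCols R' H') = inner ℝ R R' + inner ℝ H H' := by
  simp only [inner_def, appendCols_mul_transpose, trace_add]

theorem hat_appendCols_mul_transpose (hr : 1 ≤ r) (R : Matrix (Fin n) (Fin r) ℝ) :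
    hat (appendCols R (0 : Matrix (Fin n) (Fin τ) ℝ)) *
        (hat (appendCols R (0 : Matrix (Fin n) (Fin τ) ℝ)))ᵀ =
      hat R * (hat R)ᵀ := by
  ext (i | i) (j | j) <;>
    simp [mul_apply, hat, Fin.sum_univ_add, e₁_castAdd, e₁_natAdd hr]

/-- The factors live on disjoint columns. This is why a rank-raising step changes `R̂R̂ᵀ` only to
second order. -/
theorem hat_appendCols_mul_hatVar (hr : 1 ≤ r) (R : Matrix (Fin n) (Fin r) ℝ)
    (H : Matrix (Fin n) (Fin τ) ℝ) :
    hat (appendCols R (0 : Matrix (Fin n) (Fin τ) ℝ)) *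
        (hatVar (appendCols (0 : Matrix (Fin n) (Fin r) ℝ) H))ᵀ = 0 := by
  ext (i | i) (j | j) <;>
    simp [mul_apply, hat, hatVar, Fin.sum_univ_add, e₁_natAdd hr]

variable {A : Matrix (Fin m) (Fin n) ℝ} {b : Fin m → ℝ} {B : Finset (Fin n)}

theorem appendCols_mem_variety (hr : 1 ≤ r) {R : Matrix (Fin n) (Fin r) ℝ}
    (hR : R ∈ variety A b B r) :
    appendCols R (0 : Matrix (Fin n) (Fin τ) ℝ) ∈ variety A b B (r + τ) := by
  refine ⟨?_, ?_⟩
  · rw [mul_appendCols, vecMulVec_e₁_add hr, hR.1, Matrix.mul_zero]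
  · rw [appendCols_mul_transpose, appendCols_mulVec hr, Matrix.zero_mul, add_zero, hR.2]

theorem appendCols_mem_tangent (hr : 1 ≤ r) (R : Matrix (Fin n) (Fin r) ℝ)
    {H : Matrix (Fin n) (Fin τ) ℝ} (hH : A * H = 0) :
    appendCols 0 H ∈ tangent A B (appendCols R (0 : Matrix (Fin n) (Fin τ) ℝ)) := by
  simp only [tangent, hMap, Set.mem_ofPred_eq]
  refine Prod.ext ?_ (funext fun i => ?_)
  · simp [mul_appendCols, hH]
  · simp [appendCols_mul_transpose, appendCols_mulVec hr, diagB]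

theorem hMap_appendCols_left (hr : 1 ≤ r) (R G : Matrix (Fin n) (Fin r) ℝ)
    (hG : hMap A B R G = 0) :
    hMap A B (appendCols R (0 : Matrix (Fin n) (Fin τ) ℝ)) (appendCols G 0) = 0 := by
  have h1 : A * G = 0 := congrArg Prod.fst hG
  have h2 := congrArg Prod.snd hG
  refine Prod.ext ?_ (funext fun i => ?_)
  · simp [hMap, mul_appendCols, h1]
  · simpa [hMap, appendCols_mul_transpose, appendCols_mulVec hr] using congrFun h2 i

/-- Multipliers for `R`, padded by zero columns, serve for `[R, 0]` with the same `μ`, hence the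
same `L`. -/
theorem hAdj_appendCols (hr : 1 ≤ r) (R : Matrix (Fin n) (Fin r) ℝ)
    (p : Matrix (Fin m) (Fin r) ℝ × (B → ℝ)) :
    hAdj A B (appendCols R (0 : Matrix (Fin n) (Fin τ) ℝ)) (appendCols p.1 0, p.2) =
      appendCols (hAdj A B R p) 0 := by
  simp [hAdj, vecMulVec_e₁_add hr, mul_appendCols, smul_appendCols, appendCols_sub,
    appendCols_add]

variable (Q : Matrix (Fin n) (Fin n) ℝ) (c : Fin n → ℝ)
  (K : Set (Matrix (Unit ⊕ Fin n) (Unit ⊕ Fin n) ℝ)) (σ : ℝ)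
  (Wt : Matrix (Unit ⊕ Fin n) (Unit ⊕ Fin n) ℝ)

theorem objective_appendCols (hr : 1 ≤ r) (R : Matrix (Fin n) (Fin r) ℝ) :
    objective Q c K σ Wt (appendCols R (0 : Matrix (Fin n) (Fin τ) ℝ)) =
      objective Q c K σ Wt R := by
  rw [objective, hat_appendCols_mul_transpose hr]; rfl

theorem gradPhi_appendCols (hr : 1 ≤ r) (R : Matrix (Fin n) (Fin r) ℝ) :
    gradPhi Q c K Wt σ (appendCols R (0 : Matrix (Fin n) (Fin τ) ℝ)) = gradPhi Q c K Wt σ R := by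
  rw [gradPhi, dualW, hat_appendCols_mul_transpose hr]; rfl

theorem gradObjective_appendCols (hr : 1 ≤ r) (R : Matrix (Fin n) (Fin r) ℝ) :
    gradObjective Q c K Wt σ (appendCols R (0 : Matrix (Fin n) (Fin τ) ℝ)) =
      appendCols (gradObjective Q c K Wt σ R) 0 := by
  simp only [gradObjective, gradPhi_appendCols _ _ _ _ _ hr, toRows₂_mul_hat,
    vecMulVec_e₁_add hr, mul_appendCols, appendCols_add, smul_appendCols, Matrix.mul_zero,
    add_zero, smul_zero]

end AppendCols

end RNNAL

namespace RNNAL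

/-! ### Expansion along the retraction. -/

section SecondOrder

variable {m n r τ : ℕ} {Q : Matrix (Fin n) (Fin n) ℝ} (c : Fin n → ℝ)
  {A : Matrix (Fin m) (Fin n) ℝ} {b : Fin m → ℝ} {B : Finset (Fin n)}
  (K : Set (Matrix (Unit ⊕ Fin n) (Unit ⊕ Fin n) ℝ)) {σ : ℝ}
  (Wt : Matrix (Unit ⊕ Fin n) (Unit ⊕ Fin n) ℝ)

theorem abs_inner_mul_add_smul_sub_le {s : ℕ} (L : Matrix (Fin n) (Fin n) ℝ)
    (U D : Matrix (Fin n) (Fin s) ℝ) (t : ℝ) :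
    |inner ℝ (L * (t • U + D)) (t • U + D) - inner ℝ (L * U) U * t ^ 2| ≤
      ‖L‖ * (2 * (|t| * ‖U‖ * ‖D‖) + ‖D‖ ^ 2) := by
  have h : ∀ X Y : Matrix (Fin n) (Fin s) ℝ, |inner ℝ (L * X) Y| ≤ ‖L‖ * ‖X‖ * ‖Y‖ :=
    fun X Y => (abs_real_inner_le_norm _ _).trans (by gcongr; exact frobenius_norm_mul _ _)
  have e : inner ℝ (L * (t • U + D)) (t • U + D) - inner ℝ (L * U) U * t ^ 2 =
      inner ℝ (L * (t • U)) D + inner ℝ (L * D) (t • U) + inner ℝ (L * D) D := by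
    simp only [Matrix.mul_add, Matrix.mul_smul, inner_add_left, inner_add_right,
      inner_smul_left, inner_smul_right, RCLike.conj_to_real]
    ring
  rw [e]
  have h1 := h (t • U) D
  have h2 := h D (t • U)
  have h3 := h D D
  rw [norm_smul, Real.norm_eq_abs] at h1 h2
  have h4 := abs_add_three (inner ℝ (L * (t • U)) D) (inner ℝ (L * D) (t • U)) (inner ℝ (L * D) D)
  nlinarith

/-- The variation of the objective between two feasible points, up to terms of second order in
the change of `R̂ R̂ᵀ`. -/
theorem abs_objective_sub_le_of_feasible {s : ℕ} (hσ : 0 < σ) (hQ : Q.IsSymm)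
    {P E : Matrix (Fin n) (Fin s) ℝ} (hP : P ∈ variety A b B s) (hPE : P + E ∈ variety A b B s)
    (p : Matrix (Fin m) (Fin s) ℝ × (B → ℝ)) :
    |objective Q c K σ Wt (P + E) - objective Q c K σ Wt P
        - inner ℝ (gradObjective Q c K Wt σ P - hAdj A B P p) E
        - inner ℝ (dualL Q B (dualW K σ Wt P) p.2 * E) E|
      ≤ σ * (2 * ‖hat P * (hatVar E)ᵀ‖ + ‖E‖ ^ 2) ^ 2 := by
  have h1 : inner ℝ (hAdj A B P p) E = -inner ℝ (diagBAdj B p.2 * E) E := by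
    -- The constraints equal their second-order expansion exactly and vanish at `P` and at `P + E`.
    have h : ∀ k, coord B k (hMap A B P E) = -coord B k (0, diagB B (E * Eᵀ)) := fun k => by
      have := constraint_add A b B k P E
      rw [(mem_variety_iff A b B _).1 hP, (mem_variety_iff A b B _).1 hPE,
        inner_gradConstraint] at this
      linarith
    rw [inner_hAdj, inner_diagBAdj_mul]
    simp only [h, Fintype.sum_sum_type]
    simp [coord]
  have h2 : inner ℝ (dualL Q B (dualW K σ Wt P) p.2 * E) E =
      inner ℝ ((gradPhi Q c K Wt σ P).toBlocks₂₂ * E) E - inner ℝ (diagBAdj B p.2 * E) E := by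
    have : dualL Q B (dualW K σ Wt P) p.2 =
        (gradPhi Q c K Wt σ P).toBlocks₂₂ - diagBAdj B p.2 := by
      have : (gradPhi Q c K Wt σ P).toBlocks₂₂ = Q - (dualW K σ Wt P).toBlocks₂₂ := rfl
      rw [this, dualL]; abel
    rw [this, Matrix.sub_mul, inner_sub_left]
  have h3 := abs_objective_add_sub_le c K Wt hσ hQ P E
  rw [inner_sub_left, h1, h2]
  convert h3 using 2
  ring

/-- Second-order expansion of the objective along the metric-projection retraction in a direction
`[0, H]` that increases the rank. -/
theorem exists_rtr_expansion (hσ : 0 < σ) (hQ : Q.IsSymm) (hr : 1 ≤ r)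
    {R : Matrix (Fin n) (Fin r) ℝ} (hR : R ∈ variety A b B r)
    (hL : LICQ A b B (appendCols R (0 : Matrix (Fin n) (Fin τ) ℝ)))
    {p : Matrix (Fin m) (Fin r) ℝ × (B → ℝ)}
    (hp : hMap A B R (gradObjective Q c K Wt σ R - hAdj A B R p) = 0)
    {H : Matrix (Fin n) (Fin τ) ℝ} (hH : A * H = 0) :
    ∃ ρ : ℝ → Matrix (Fin n) (Fin (r + τ)) ℝ,
      (∀ᶠ t in 𝓝 (0 : ℝ), rtr A b B (appendCols R 0) (t • appendCols 0 H) = {ρ t}) ∧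
      (fun t : ℝ => objective Q c K σ Wt (ρ t)
          - (objective Q c K σ Wt R
              + inner ℝ (dualL Q B (dualW K σ Wt R) p.2) (H * Hᵀ) * t ^ 2))
        =o[𝓝 0] fun t : ℝ => t ^ 2 := by
  set P := appendCols R (0 : Matrix (Fin n) (Fin τ) ℝ) with hPdef
  set U := appendCols (0 : Matrix (Fin n) (Fin r) ℝ) H with hUdef
  set T := appendCols (gradObjective Q c K Wt σ R - hAdj A B R p)
    (0 : Matrix (Fin n) (Fin τ) ℝ) with hTdef
  set L := dualL Q B (dualW K σ Wt R) p.2 with hLdef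
  have hPM : P ∈ variety A b B (r + τ) := appendCols_mem_variety hr hR
  have hUt : hMap A B P U = 0 := appendCols_mem_tangent hr R hH
  have hTt : hMap A B P T = 0 := hMap_appendCols_left hr R _ hp
  have hcz : ∀ k : (Fin m × Fin (r + τ)) ⊕ B, coord B k 0 = 0 := by
    rintro (k | k) <;> rfl
  obtain ⟨C, hC, hlip⟩ := exists_gradConstraint_bounds B m (r + τ) A
  obtain ⟨ρ, M, hρ⟩ := exists_nearest_curve (g := constraint A b B (r + τ))
    (G := gradConstraint A B) (C := C) (P := P) (U := U) (by linarith)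
    (fun k x y => by
      have h := constraint_add A b B k x (y - x)
      rw [add_sub_cancel] at h
      rw [h, add_assoc, add_sub_cancel_left, add_sub_cancel_left]
      exact (abs_coord_zero_diagB_le B k _).trans (le_mul_of_one_le_left (by positivity) hC))
    hlip hL.linearIndependent_gradConstraint ((mem_variety_iff A b B P).1 hPM)
    (fun k => by rw [inner_gradConstraint, hUt, hcz])
  have hset : ∀ t : ℝ, rtr A b B P (t • U) =
      {Z | (∀ k, constraint A b B (r + τ) k Z = 0) ∧
        ∀ Y, (∀ k, constraint A b B (r + τ) k Y = 0) →
          ‖Z - (P + t • U)‖ ≤ ‖Y - (P + t • U)‖} := fun t => by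
    ext Z
    simp only [rtr, metricProj, mem_variety_iff, Set.mem_ofPred_eq]
  refine ⟨ρ, hρ.mono fun t ht => (hset t).trans ht.1, ?_⟩
  set a := ‖U‖
  set d := ‖hat P‖
  -- The constant `M` comes with no sign; its absolute value is used for monotonicity.
  set k := |M|
  have hk0 : 0 ≤ k := abs_nonneg M
  -- The three summands bound `⟪T, D⟫`, the error in `⟪LE, E⟫`, and the remainder of `φ`, each times
  -- `|t|³`.
  set c₀ := k * ‖T‖ + ‖L‖ * (2 * (a * k) + k ^ 2) + σ * (2 * (d * k) + (a + k) ^ 2) ^ 2 with hc₀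
  have hbound : ∀ᶠ t in 𝓝 (0 : ℝ), ‖objective Q c K σ Wt (ρ t)
      - (objective Q c K σ Wt R + inner ℝ L (H * Hᵀ) * t ^ 2)‖ ≤ c₀ * ‖|t| ^ 3‖ := by
    have ht1 : ∀ᶠ t in 𝓝 (0 : ℝ), |t| < 1 := by
      have h : Tendsto (fun t : ℝ => |t|) (𝓝 0) (𝓝 0) := by
        simpa using (continuous_abs (G := ℝ)).tendsto 0
      exact h.eventually (gt_mem_nhds one_pos)
    filter_upwards [hρ, ht1] with t ⟨hmem, hD, hTD⟩ ht
    set D := ρ t - (P + t • U) with hDdef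
    set u := |t| with hu
    have hu0 : 0 ≤ u := abs_nonneg t
    have hut : t ^ 2 = u ^ 2 := (sq_abs t).symm
    have hD : ‖D‖ ≤ k * u ^ 2 := by
      rw [hut] at hD; exact hD.trans (by gcongr; exact le_abs_self M)
    have hTD : |inner ℝ T D| ≤ k * ‖T‖ * u ^ 3 :=
      (hTD T fun k => by rw [inner_gradConstraint, hTt, hcz]).trans
        (by gcongr; exact le_abs_self M)
    have hρE : ρ t = P + (t • U + D) := by rw [hDdef]; abel
    have hρM : P + (t • U + D) ∈ variety A b B (r + τ) := by
      rw [← hρE, mem_variety_iff]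
      exact (hmem.symm ▸ Set.mem_singleton (ρ t) : ρ t ∈ {Z | _ ∧ _}).1
    have h1 := abs_objective_sub_le_of_feasible c K Wt hσ hQ hPM hρM (appendCols p.1 0, p.2)
    rw [hPdef, hAdj_appendCols hr, gradObjective_appendCols Q c K σ Wt hr, appendCols_sub, sub_zero,
      objective_appendCols Q c K σ Wt hr, ← hTdef, ← hPdef, ← hρE] at h1
    have hdual : dualW K σ Wt P = dualW K σ Wt R := by
      rw [dualW, hat_appendCols_mul_transpose hr]; rfl
    rw [hdual, ← hLdef] at h1
    -- `T` is supported on the first `r` columns and `U` on the last `τ`.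
    have hTU : inner ℝ T (t • U + D) = inner ℝ T D := by
      rw [inner_add_right, inner_smul_right, hTdef, hUdef, inner_appendCols]
      simp
    rw [hTU] at h1
    have h2 := abs_inner_mul_add_smul_sub_le L U D t
    have hLU : inner ℝ (L * U) U = inner ℝ L (H * Hᵀ) := by
      rw [hUdef, mul_appendCols, inner_appendCols, Matrix.mul_zero, inner_zero_left, zero_add,
        inner_def, inner_def, transpose_mul, transpose_transpose, Matrix.mul_assoc]
    rw [hLU] at h2
    -- The `tU` part is annihilated, so only `D = O(t²)` contributes.
    have h3 : ‖hat P * (hatVar (t • U + D))ᵀ‖ ≤ d * k * u ^ 2 := by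
      rw [hatVar_add, hatVar_smul, transpose_add, transpose_smul, Matrix.mul_add, Matrix.mul_smul,
        hPdef, hUdef, hat_appendCols_mul_hatVar hr, smul_zero, zero_add, ← hPdef]
      refine (frobenius_norm_mul _ _).trans ?_
      rw [frobenius_norm_transpose, norm_hatVar, mul_assoc]
      gcongr
    have h4 : ‖t • U + D‖ ≤ (a + k) * u := by
      refine (norm_add_le _ _).trans ?_
      rw [norm_smul, Real.norm_eq_abs]
      have : k * u ^ 2 ≤ k * u := by gcongr; nlinarith
      linarith [mul_comm u a]
    have h5 : σ * (2 * ‖hat P * (hatVar (t • U + D))ᵀ‖ + ‖t • U + D‖ ^ 2) ^ 2 ≤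
        σ * (2 * (d * k) + (a + k) ^ 2) ^ 2 * u ^ 3 := by
      have : σ * (2 * ‖hat P * (hatVar (t • U + D))ᵀ‖ + ‖t • U + D‖ ^ 2) ^ 2 ≤
        σ * (2 * (d * k * u ^ 2) + ((a + k) * u) ^ 2) ^ 2 := by gcongr
      refine this.trans ?_
      have e : σ * (2 * (d * k * u ^ 2) + ((a + k) * u) ^ 2) ^ 2 =
        σ * (2 * (d * k) + (a + k) ^ 2) ^ 2 * u ^ 4 := by ring
      rw [e]
      gcongr ?_ * ?_
      exact pow_le_pow_of_le_one hu0 ht.le (by norm_num)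
    have h6 : ‖L‖ * (2 * (u * a * ‖D‖) + ‖D‖ ^ 2) ≤ ‖L‖ * (2 * (a * k) + k ^ 2) * u ^ 3 := by
      have : ‖L‖ * (2 * (u * a * ‖D‖) + ‖D‖ ^ 2) ≤
          ‖L‖ * (2 * (u * a * (k * u ^ 2)) + (k * u ^ 2) ^ 2) := by gcongr
      refine this.trans ?_
      rw [mul_assoc ‖L‖ _ (u ^ 3)]
      refine mul_le_mul_of_nonneg_left ?_ (norm_nonneg L)
      have h43 : u ^ 4 ≤ u ^ 3 := pow_le_pow_of_le_one hu0 ht.le (by norm_num)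
      nlinarith [mul_le_mul_of_nonneg_left h43 (sq_nonneg k)]
    have h7 : objective Q c K σ Wt (ρ t) - (objective Q c K σ Wt R + inner ℝ L (H * Hᵀ) * t ^ 2) =
        (objective Q c K σ Wt (ρ t) - objective Q c K σ Wt R - inner ℝ T D
          - inner ℝ (L * (t • U + D)) (t • U + D)) + inner ℝ T D +
        (inner ℝ (L * (t • U + D)) (t • U + D) - inner ℝ L (H * Hᵀ) * t ^ 2) := by ring
    rw [h7, Real.norm_eq_abs, Real.norm_of_nonneg (by positivity : 0 ≤ u ^ 3)]
    refine (abs_add_three _ _ _).trans ?_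
    rw [hc₀]
    linarith
  refine (IsBigO.of_bound c₀ hbound).trans_isLittleO ?_
  have h : (fun t : ℝ => t ^ 3) =o[𝓝 0] fun t : ℝ => t ^ 2 := isLittleO_pow_pow (by norm_num)
  refine IsLittleO.of_norm_left (h.norm_left.congr_left fun t => ?_)
  simp

theorem LICQ.exists_unique_multiplier {R : Matrix (Fin n) (Fin r) ℝ} (h : LICQ A b B R)
    (X : Matrix (Fin n) (Fin r) ℝ) : ∃ p : Matrix (Fin m) (Fin r) ℝ × (B → ℝ),
      (∀ p', hMap A B R (hAdj A B R p') = hMap A B R X ↔ p' = p) ∧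
        hMap A B R (X - hAdj A B R p) = 0 := by
  obtain ⟨p, hp⟩ := h.normal_surjective (hMap A B R X)
  refine ⟨p, fun p' => ⟨fun h' => h.normal_injective (h'.trans hp.symm), ?_⟩, ?_⟩
  · rintro rfl; exact hp
  · exact ((hLin A B R).map_sub X (hAdj A B R p)).trans (sub_eq_zero.2 hp.symm)

end SecondOrder

/-! ### The recovered dual matrix and its negative eigenvectors. -/

section Recovery

variable {m n r τ : ℕ} {Q : Matrix (Fin n) (Fin n) ℝ} (c : Fin n → ℝ)
  {A : Matrix (Fin m) (Fin n) ℝ} {b : Fin m → ℝ} {B : Finset (Fin n)}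
  (K : Set (Matrix (Unit ⊕ Fin n) (Unit ⊕ Fin n) ℝ)) {σ : ℝ}
  (Wt : Matrix (Unit ⊕ Fin n) (Unit ⊕ Fin n) ℝ)

theorem mul_pinv (hA : LinearIndependent ℝ A.row) : A * pinv A = 1 := by
  have hinj : Function.Injective (A * Aᵀ).mulVec := by
    have hker : ∀ x, (A * Aᵀ) *ᵥ x = 0 → x = 0 := fun x hx => by
      have h1 : Aᵀ *ᵥ x = 0 := by
        have : (Aᵀ *ᵥ x) ⬝ᵥ (Aᵀ *ᵥ x) = 0 := by
          rw [dotProduct_mulVec, vecMul_transpose, mulVec_mulVec, hx, zero_dotProduct]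
        exact dotProduct_self_eq_zero.1 this
      rw [mulVec_transpose] at h1
      exact vecMul_injective_iff.2 hA (by simpa using h1)
    intro x y hxy
    refine sub_eq_zero.1 (hker _ ?_)
    rw [mulVec_sub]
    exact sub_eq_zero.2 hxy
  have hu : IsUnit (A * Aᵀ) := mulVec_injective_iff_isUnit.1 hinj
  rw [pinv, ← Matrix.mul_assoc, mul_nonsing_inv _ ((isUnit_iff_isUnit_det _).1 hu)]

theorem pinv_mul_isSymm (A : Matrix (Fin m) (Fin n) ℝ) : (pinv A * A)ᵀ = pinv A * A := by
  simp only [pinv, transpose_mul, transpose_transpose, transpose_nonsing_inv, Matrix.mul_assoc]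

theorem projJ_transpose (A : Matrix (Fin m) (Fin n) ℝ) : (projJ A)ᵀ = projJ A := by
  rw [projJ, transpose_sub, transpose_one, pinv_mul_isSymm]

theorem mul_projJ (hA : LinearIndependent ℝ A.row) : A * projJ A = 0 := by
  rw [projJ, Matrix.mul_sub, ← Matrix.mul_assoc, mul_pinv hA]; simp

theorem projJ_mul_transpose (hA : LinearIndependent ℝ A.row) : projJ A * Aᵀ = 0 := by
  rw [← projJ_transpose, ← transpose_mul, mul_projJ hA, transpose_zero]

theorem mul_escapeMap (hA : LinearIndependent ℝ A.row) (R : Matrix (Fin n) (Fin r) ℝ)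
    (V : Matrix (Unit ⊕ Fin n) (Fin τ) ℝ) : A * (escapeMap A R * V) = 0 := by
  rw [escapeMap, ← Matrix.mul_assoc, ← Matrix.mul_assoc, mul_projJ hA]; simp

theorem dualL_isSymm (hQ : Q.IsSymm) {W : Matrix (Unit ⊕ Fin n) (Unit ⊕ Fin n) ℝ}
    (hW : W.IsSymm) (μ : B → ℝ) : (dualL Q B W μ).IsSymm := by
  have h : W.toBlocks₂₂.IsSymm := by
    ext i j; exact congrFun (congrFun hW (Sum.inr i)) (Sum.inr j)
  exact (hQ.sub (by simp [Matrix.IsSymm, diagBAdj])).sub h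

theorem dotProduct_e₁_self (hr : 1 ≤ r) : e₁ r ⬝ᵥ e₁ r = 1 := by
  have : ∀ j : Fin r, e₁ r j * e₁ r j = if j = ⟨0, hr⟩ then 1 else 0 := fun j => by
    by_cases h : j = ⟨0, hr⟩
    · simp [e₁, h]
    · have : (j : ℕ) ≠ 0 := fun h' => h (Fin.ext h')
      simp [e₁, h, this]
  simp [dotProduct, this]

variable {c K Wt}

/-- By the definitions of `L` and `q`, `2LR + qe₁ᵀ = ∇f - diag*(μ)(2R - ee₁ᵀ)`. Thus the KKT
multipliers leave zero residual and can be used in the expansion directly. -/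
theorem IsKKT.gradObjective_eq {R : Matrix (Fin n) (Fin r) ℝ} {lam : Matrix (Fin m) (Fin r) ℝ}
    {μ : B → ℝ} (h : IsKKT Q c A b B K σ Wt R lam μ) :
    gradObjective Q c K Wt σ R = hAdj A B R (lam, μ) := by
  have h1 := h.1
  rw [sub_eq_zero] at h1
  rw [hAdj, ← h1, gradObjective, toRows₂_mul_hat]
  have hN22 : (gradPhi Q c K Wt σ R).toBlocks₂₂ =
      dualL Q B (dualW K σ Wt R) μ + diagBAdj B μ := by
    have : (gradPhi Q c K Wt σ R).toBlocks₂₂ = Q - (dualW K σ Wt R).toBlocks₂₂ := rfl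
    rw [this, dualL]; abel
  rw [hN22]
  ext i j
  simp only [Matrix.add_mul, Matrix.mul_sub, Matrix.smul_apply, Matrix.add_apply,
    Matrix.sub_apply, vecMulVec_apply, diagBAdj, diagonal_mul, smul_eq_mul, dualq, gradPhi,
    toBlocks₂₁, costC, of_apply, fromBlocks_apply₂₁, replicateCol_apply]
  ring

/-- Multiplying the KKT equation by `J_A` removes `Aᵀλ`, and applying the result to `e₁` isolates
`q` because `e₁ᵀe₁ = 1`. -/
theorem IsKKT.projJ_mulVec {R : Matrix (Fin n) (Fin r) ℝ} {lam : Matrix (Fin m) (Fin r) ℝ}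
    {μ : B → ℝ} (hA : LinearIndependent ℝ A.row) (hr : 1 ≤ r)
    (h : IsKKT Q c A b B K σ Wt R lam μ) :
    projJ A *ᵥ ((2 : ℝ) • (dualL Q B (dualW K σ Wt R) μ *ᵥ (R *ᵥ e₁ r))
      + dualq c B (dualW K σ Wt R) μ) = 0 := by
  have h1 := congrArg (fun X => projJ A *ᵥ (X *ᵥ e₁ r)) (sub_eq_zero.1 h.1)
  simp only [mulVec_mulVec, ← Matrix.mul_assoc, projJ_mul_transpose hA, Matrix.zero_mul,
    zero_mulVec] at h1
  rw [← mulVec_mulVec, add_mulVec, smul_mulVec, ← mulVec_mulVec, vecMulVec_mulVec,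
    dotProduct_e₁_self hr] at h1
  simpa using h1

/-- The recovered dual matrix is `(-R e₁, I)ᵀ J_A L J_A (-R e₁, I)`. -/
theorem IsKKT.recoveredS_eq {R : Matrix (Fin n) (Fin r) ℝ} {lam : Matrix (Fin m) (Fin r) ℝ}
    {μ : B → ℝ} (hQ : Q.IsSymm) (hA : LinearIndependent ℝ A.row) (hr : 1 ≤ r)
    (h : IsKKT Q c A b B K σ Wt R lam μ) :
    recoveredS Q c A b B K σ Wt R μ =
      (escapeMap A R)ᵀ * dualL Q B (dualW K σ Wt R) μ * escapeMap A R := by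
  set W := dualW K σ Wt R with hW
  have hWs : W.IsSymm := dualW_isSymm K Wt σ R
  set L := dualL Q B W μ with hL
  have hLs : Lᵀ = L := dualL_isSymm hQ hWs μ
  set q := dualq c B W μ with hq
  set J := projJ A with hJ
  have hJs : Jᵀ = J := projJ_transpose A
  set v := J *ᵥ (R *ᵥ e₁ r) with hv
  set x := pinv A *ᵥ b with hx
  have hPJ : pinv A * A = 1 - J := by rw [hJ, projJ]; abel
  have hPT : Aᵀ * (pinv A)ᵀ = 1 - J := by
    rw [← transpose_mul, hPJ, transpose_sub, transpose_one, hJs]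
  have hRb : A *ᵥ (R *ᵥ e₁ r) = b := by
    rw [mulVec_mulVec, h.2.1, vecMulVec_mulVec, dotProduct_e₁_self hr]; simp
  have hvx : v = R *ᵥ e₁ r - x := by
    rw [hv, hJ, projJ, sub_mulVec, one_mulVec, ← mulVec_mulVec, hRb]
  have hkkt := h.projJ_mulVec hA hr
  rw [← hW, ← hL, ← hq, ← hJ, mulVec_add, mulVec_smul] at hkkt
  -- The off-diagonal block reduces to `½Jq + JLx`; stationarity gives `½Jq = -JLRe₁`, and `v = Re₁
  -- - x`.
  have hcol : (1 / 2 : ℝ) • q - (1 / 2 : ℝ) • (Aᵀ *ᵥ ((pinv A)ᵀ *ᵥ (q + L *ᵥ x))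
      - ((pinv A)ᵀ * L * ((2 : ℝ) • 1 - pinv A * A))ᵀ *ᵥ b) = -(J *ᵥ (L *ᵥ v)) := by
    have e1 : ((pinv A)ᵀ * L * ((2 : ℝ) • 1 - pinv A * A))ᵀ *ᵥ b =
        ((1 : Matrix (Fin n) (Fin n) ℝ) + J) *ᵥ (L *ᵥ x) := by
      have e2 : (2 : ℝ) • 1 - pinv A * A = 1 + J := by rw [hPJ, two_smul]; abel
      rw [e2, transpose_mul, transpose_mul, transpose_transpose, hLs, transpose_add,
        transpose_one, hJs, hx, mulVec_mulVec, mulVec_mulVec, Matrix.mul_assoc]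
    rw [e1, mulVec_mulVec, hPT, hvx]
    simp only [mulVec_sub, sub_mulVec, add_mulVec, mulVec_add, one_mulVec]
    have e3 : J *ᵥ q = -((2 : ℝ) • J *ᵥ L *ᵥ R *ᵥ e₁ r) := eq_neg_of_add_eq_zero_right hkkt
    rw [e3]
    module
  -- Together with its transpose this gives the lower block, since `(1 - J)L(1 + J) + (1 + J)L(1 -
  -- J) = 2L - 2JLJ`.
  have hblock : Aᵀ * ((pinv A)ᵀ * L * ((2 : ℝ) • 1 - pinv A * A)) = (1 - J) * L * (1 + J) := by
    have e2 : (2 : ℝ) • 1 - pinv A * A = 1 + J := by rw [hPJ, two_smul]; abel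
    rw [e2, ← Matrix.mul_assoc, ← Matrix.mul_assoc, hPT]
  have hblock' : ((pinv A)ᵀ * L * ((2 : ℝ) • 1 - pinv A * A))ᵀ * A = (1 + J) * L * (1 - J) := by
    have := congrArg transpose hblock
    rw [transpose_mul, transpose_transpose] at this
    rw [this]
    simp only [transpose_mul, transpose_add, transpose_sub, transpose_one, hJs, hLs,
      Matrix.mul_assoc]
  have hS : recoveredS Q c A b B K σ Wt R μ = fromBlocks (of fun _ _ => v ⬝ᵥ (L *ᵥ v))
      (replicateRow Unit (-(J *ᵥ (L *ᵥ v)))) (replicateCol Unit (-(J *ᵥ (L *ᵥ v))))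
      (J * L * J) := by
    have hW12 : ∀ i, W (Sum.inl ()) (Sum.inr i) = W (Sum.inr i) (Sum.inl ()) := fun i =>
      (congrFun (congrFun hWs (Sum.inl ())) (Sum.inr i)).symm
    simp only [recoveredS, ← hW, ← hL, ← hq, ← hJ, ← hx, ← hv]
    have hcol' : ∀ i, c i - opAAdjCol A b B ((pinv A)ᵀ *ᵥ (q + L *ᵥ x),
        (pinv A)ᵀ * L * ((2 : ℝ) • 1 - pinv A * A), μ, -(v ⬝ᵥ (L *ᵥ v)) - W.toBlocks₁₁ () ()) i
        - W (Sum.inr i) (Sum.inl ()) = -(J *ᵥ (L *ᵥ v)) i := fun i => by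
      have h1 := congrFun hcol i
      have h2 : q i = 2 * c i + extendB B μ i - 2 * W (Sum.inr i) (Sum.inl ()) := rfl
      simp only [Pi.sub_apply, Pi.smul_apply, Pi.neg_apply, smul_eq_mul, h2] at h1
      rw [← h1]
      simp only [opAAdjCol, Pi.sub_apply, Pi.smul_apply, smul_eq_mul]
      ring
    ext (i | i) (j | j)
    · simp [costC, opAAdj, toBlocks₁₁]
    · simpa [costC, opAAdj, hW12] using hcol' j
    · simpa [costC, opAAdj] using hcol' i
    · have e1 : (costC Q c - opAAdj A b B ((pinv A)ᵀ *ᵥ (q + L *ᵥ x),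
          (pinv A)ᵀ * L * ((2 : ℝ) • 1 - pinv A * A), μ,
          -(v ⬝ᵥ (L *ᵥ v)) - W.toBlocks₁₁ () ()) - W).toBlocks₂₂ = J * L * J := by
        have e2 : ∀ X Y : Matrix (Unit ⊕ Fin n) (Unit ⊕ Fin n) ℝ,
          (X - Y).toBlocks₂₂ = X.toBlocks₂₂ - Y.toBlocks₂₂ := fun _ _ => rfl
        have e3 : Q - diagBAdj B μ - W.toBlocks₂₂ = L := rfl
        rw [e2, e2, costC, opAAdj, toBlocks_fromBlocks₂₂, toBlocks_fromBlocks₂₂, hblock, hblock',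
          sub_add_eq_sub_sub_swap, sub_right_comm, e3]
        simp only [Matrix.add_mul, Matrix.sub_mul, Matrix.mul_add, Matrix.mul_sub,
          Matrix.one_mul, Matrix.mul_one]
        module
      exact congrFun (congrFun e1 i) j
  have hesc : escapeMap A R = fromCols (replicateCol Unit (-v)) J := by
    rw [escapeMap, ← hJ, mul_fromCols, Matrix.mul_one]
    rw [← replicateCol_mulVec, mulVec_neg]
  rw [hS, hesc, transpose_fromCols, fromRows_mul, fromRows_mul_fromCols, hJs]
  congr 1
  · ext i j
    rw [dotProduct_mulVec, transpose_replicateCol]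
    simp [Matrix.mul_apply, vecMul, dotProduct]
  · ext i j
    have : -(J *ᵥ (L *ᵥ v)) = -(v ᵥ* L ᵥ* J) := by
      rw [← mulVec_transpose, ← mulVec_transpose, hJs, hLs]
    rw [this, transpose_replicateCol, vecMul_vecMul, Matrix.mul_assoc]
    simp [Matrix.mul_apply, vecMul, dotProduct]
  · ext i j
    rw [mulVec_mulVec]
    simp [Matrix.mul_apply, mulVec, dotProduct]

theorem IsKKT.inner_recoveredS {R : Matrix (Fin n) (Fin r) ℝ} {lam : Matrix (Fin m) (Fin r) ℝ}
    {μ : B → ℝ} (hQ : Q.IsSymm) (hA : LinearIndependent ℝ A.row) (hr : 1 ≤ r)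
    (h : IsKKT Q c A b B K σ Wt R lam μ) (V : Matrix (Unit ⊕ Fin n) (Fin τ) ℝ) :
    inner ℝ (dualL Q B (dualW K σ Wt R) μ) (escapeMap A R * V * (escapeMap A R * V)ᵀ) =
      inner ℝ (recoveredS Q c A b B K σ Wt R μ) (V * Vᵀ) := by
  rw [h.recoveredS_eq hQ hA hr, inner_def, inner_def]
  simp only [transpose_mul, transpose_transpose, ← Matrix.mul_assoc]
  rw [Matrix.trace_mul_comm]
  simp only [← Matrix.mul_assoc]

/-- The inner product is the sum of `θⱼ‖vⱼ‖²`; `0 < τ` makes the sum nonempty. -/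
theorem inner_mul_transpose_neg_of_eigenvectors {p : Type*} [Fintype p] [DecidableEq p]
    (hτ : 0 < τ) (S : Matrix p p ℝ) (V : Matrix p (Fin τ) ℝ)
    (hV : ∀ j, ∃ θ : ℝ, θ < 0 ∧ Module.End.HasEigenvector (Matrix.toLin' S) θ (V.col j)) :
    inner ℝ S (V * Vᵀ) < 0 := by
  have h1 : inner ℝ S (V * Vᵀ) = ∑ j, V.col j ⬝ᵥ (S *ᵥ V.col j) := by
    rw [inner_def, transpose_mul, transpose_transpose, ← Matrix.mul_assoc, trace_mul_comm]
    rfl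
  rw [h1]
  refine Finset.sum_neg (fun j _ => ?_) ⟨⟨0, hτ⟩, Finset.mem_univ _⟩
  obtain ⟨θ, hθ, he⟩ := hV j
  have h2 : S *ᵥ V.col j = θ • V.col j := by simpa using he.apply_eq_smul
  rw [h2, dotProduct_smul, smul_eq_mul]
  refine mul_neg_of_neg_of_pos hθ ?_
  exact lt_of_le_of_ne (Finset.sum_nonneg fun i _ => mul_self_nonneg _)
    fun h0 => he.2 (dotProduct_self_eq_zero.1 h0.symm)

end Recovery

/-! ### Strict descent and the main theorem. -/

theorem eventually_lt_of_isLittleO_sq {f : ℝ → ℝ} {f₀ β : ℝ} (hβ : β < 0)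
    (h : (fun t : ℝ => f t - (f₀ + β * t ^ 2)) =o[𝓝 0] fun t : ℝ => t ^ 2) :
    ∀ᶠ t in 𝓝[≠] (0 : ℝ), f t < f₀ := by
  -- An error of at most `-β t² / 2` still leaves a decrease of `|β| t² / 2`.
  have h1 := h.def (show 0 < -β / 2 by linarith)
  filter_upwards [h1.filter_mono nhdsWithin_le_nhds, self_mem_nhdsWithin] with t ht ht0
  have h2 : 0 < t ^ 2 := by
    have : t ≠ 0 := ht0
    positivity
  rw [Real.norm_eq_abs, Real.norm_of_nonneg h2.le] at ht
  have := (abs_le.1 ht).2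
  nlinarith

end RNNAL

theorem theorem4p2 {m n : ℕ}
    (Q : Matrix (Fin n) (Fin n) ℝ) (hQ : Q.IsSymm) (c : Fin n → ℝ)
    (A : Matrix (Fin m) (Fin n) ℝ) (hA : LinearIndependent ℝ A.row)
    (b : Fin m → ℝ) (B : Finset (Fin n))
    (K : Set (Matrix (Unit ⊕ Fin n) (Unit ⊕ Fin n) ℝ)) (hK : IsPolyhedralCone K)
    (σ : ℝ) (hσ : 0 < σ)
    (Wt : Matrix (Unit ⊕ Fin n) (Unit ⊕ Fin n) ℝ) (hWt : Wt.IsSymm)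
    (rbar : ℕ) (hrbar : 1 ≤ rbar)
    (hLICQ : ∀ s : ℕ, rbar ≤ s →
      (variety A b B s).Nonempty ∧ ∀ R ∈ variety A b B s, LICQ A b B R)
    (r : ℕ) (hr : rbar ≤ r) :
    -- second-order expansion at an arbitrary feasible point
    (∀ R ∈ variety A b B r,
      DifferentiableAt ℝ
        (fun X : Matrix (Fin n) (Fin r) ℝ => objective Q c K σ Wt X) R ∧
      ∃ p : Matrix (Fin m) (Fin r) ℝ × (B → ℝ),
        (∀ p', hMap A B R (hAdj A B R p') =
            hMap A B R (gradient
              (fun X : Matrix (Fin n) (Fin r) ℝ => objective Q c K σ Wt X) R) ↔ p' = p) ∧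
        ∀ τ : ℕ, 0 < τ → ∀ H : Matrix (Fin n) (Fin τ) ℝ, A * H = 0 →
          appendCols R 0 ∈ variety A b B (r + τ) ∧
          appendCols 0 H ∈ tangent A B (appendCols R (0 : Matrix (Fin n) (Fin τ) ℝ)) ∧
          ∃ ρ : ℝ → Matrix (Fin n) (Fin (r + τ)) ℝ,
            (∀ᶠ t in 𝓝 (0 : ℝ),
              rtr A b B (appendCols R 0) (t • appendCols 0 H) = {ρ t}) ∧
            (fun t : ℝ => objective Q c K σ Wt (ρ t)
                - (objective Q c K σ Wt R
                    + inner ℝ (dualL Q B (dualW K σ Wt R) p.2) (H * Hᵀ) * t ^ 2))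
              =o[𝓝 0] fun t : ℝ => t ^ 2) ∧
    -- escaping from a stationary point by increasing the rank
    (∀ (R : Matrix (Fin n) (Fin r) ℝ) (lam : Matrix (Fin m) (Fin r) ℝ) (μ : B → ℝ),
      IsKKT Q c A b B K σ Wt R lam μ →
      ∀ τ : ℕ, 0 < τ → ∀ V : Matrix (Unit ⊕ Fin n) (Fin τ) ℝ,
        (∀ j, ∃ θ : ℝ, θ < 0 ∧
          Module.End.HasEigenvector
            (Matrix.toLin' (recoveredS Q c A b B K σ Wt R μ)) θ (V.col j)) →
        inner ℝ (recoveredS Q c A b B K σ Wt R μ) (V * Vᵀ) < 0 ∧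
        appendCols R 0 ∈ variety A b B (r + τ) ∧
        appendCols 0 (escapeMap A R * V) ∈
          tangent A B (appendCols R (0 : Matrix (Fin n) (Fin τ) ℝ)) ∧
        ∃ ρ : ℝ → Matrix (Fin n) (Fin (r + τ)) ℝ,
          (∀ᶠ t in 𝓝 (0 : ℝ),
            rtr A b B (appendCols R 0) (t • appendCols 0 (escapeMap A R * V)) = {ρ t}) ∧
          ((fun t : ℝ => objective Q c K σ Wt (ρ t)
              - (objective Q c K σ Wt R
                  + inner ℝ (recoveredS Q c A b B K σ Wt R μ) (V * Vᵀ) * t ^ 2))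
            =o[𝓝 0] fun t : ℝ => t ^ 2) ∧
          ∀ᶠ t in 𝓝[≠] (0 : ℝ), objective Q c K σ Wt (ρ t) < objective Q c K σ Wt R) := by
  have hr1 : 1 ≤ r := hrbar.trans hr
  -- The retraction takes place at `[R, 0]`, so LICQ is needed with `r + τ` columns.
  have hLr : ∀ (τ : ℕ), ∀ R ∈ variety A b B r,
      LICQ A b B (appendCols R (0 : Matrix (Fin n) (Fin τ) ℝ)) := fun τ R hR =>
    (hLICQ (r + τ) (by omega)).2 _ (appendCols_mem_variety hr1 hR)
  refine ⟨fun R hR => ?_, fun R lam μ hkkt τ hτ V hV => ?_⟩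
  · have hgrad := hasGradientAt_objective c K Wt hσ hQ R
    obtain ⟨p, hp, hp0⟩ :=
      ((hLICQ r hr).2 R hR).exists_unique_multiplier (gradObjective Q c K Wt σ R)
    refine ⟨hgrad.hasFDerivAt.differentiableAt, p, by rwa [hgrad.gradient], fun τ _ H hH => ?_⟩
    exact ⟨appendCols_mem_variety hr1 hR, appendCols_mem_tangent hr1 R hH,
      exists_rtr_expansion c K Wt hσ hQ hr1 hR (hLr τ R hR) hp0 hH⟩
  · have hneg := inner_mul_transpose_neg_of_eigenvectors hτ _ V hV
    have hAV : A * (escapeMap A R * V) = 0 := mul_escapeMap hA R V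
    have hp0 : hMap A B R (gradObjective Q c K Wt σ R - hAdj A B R (lam, μ)) = 0 := by
      rw [hkkt.gradObjective_eq, sub_self]
      exact (hLin A B R).map_zero
    obtain ⟨ρ, hρ, hexp⟩ :=
      exists_rtr_expansion c K Wt hσ hQ hr1 hkkt.2 (hLr τ R hkkt.2) hp0 hAV
    rw [hkkt.inner_recoveredS hQ hA hr1] at hexp
    exact ⟨hneg, appendCols_mem_variety hr1 hkkt.2, appendCols_mem_tangent hr1 R hAV, ρ, hρ, hexp,
      eventually_lt_of_isLittleO_sq hneg hexp⟩
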